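/- Let $k$ be a field. A Poisson algebra is a commutative unital $k$-algebra $P$ with a $k$-bilinear Lie bracket $[-,-]$ such that $[p,qr]=[p,q]r+q[p,r]$; the tensor product of two Poisson algebras carries the bracket $[p\otimes q,\,r\otimes s]=pr\otimes[q,s]+[p,r]\otimes qs$, and $k$ carries the zero bracket. A Poisson ideal is an ideal of the associative algebra that is also a Lie ideal. A Poisson bialgebra is a commutative $k$-bialgebra with a Poisson bracket such that $\Delta$ and $\varepsilon$ are maps of Poisson algebras; a Poisson Hopf algebra is a Poisson bialgebra with an antipode. Morphisms of Poisson bialgebras are the bialgebra maps preserving the bracket; morphisms of Poisson Hopf algebras are those that also preserve the antipode. For a Poisson bialgebra $B$, let $B^{\mathrm{op},\mathrm{cop}}$ be the same algebra with the same counit, the comultiplication $b\mapsto b_{(2)}\otimes b_{(1)}$ and the bracket $(a,b)\mapsto[b,a]$. **Theorem.** The forgetful functor from Poisson Hopf algebras to Poisson bialgebras is fully faithful and has a left adjoint; thus Poisson Hopf algebras form a reflective subcategory of the category of Poisson bialgebras. More explicitly, let $B$ be a Poisson bialgebra and, for $n\ge 0$, let $B_n=B$ if $n$ is even and $B_n=B^{\mathrm{op},\mathrm{cop}}$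 if $n$ is odd. Then the coproduct $\bigl(C,(q_n\colon B_n\to C)_{n\ge 0}\bigr)$ of the family $(B_n)_{n\ge0}$ in the category of Poisson bialgebras exists, and the following hold. 1. There is a unique morphism of Poisson bialgebras $S'\colon C\to C^{\mathrm{op},\mathrm{cop}}$ such that $S'(q_n(b))=q_{n+1}(b)$ for all $n\ge0$ and all $b$ in the common underlying set of the $B_n$. 2. Let $\mathcal I$ be the Poisson ideal of $C$ generated by the elements $(S'*\mathrm{Id}-u_C\circ\varepsilon_C)(q_n(x))$ and $(\mathrm{Id}*S'-u_C\circ\varepsilon_C)(q_n(x))$ for $n\ge0$ and $x\in B_n$, where $*$ is the convolution product of linear maps $C\to C$ and $u_C\colon k\to C$ is the unit map. Then $\mathcal I$ is a Hopf ideal: $\varepsilon_C(\mathcal I)=0$, $\Delta_C(\mathcal I)\subseteq C\otimes\mathcal I+\mathcal I\otimes C$ and $S'(\mathcal I)\subseteq\mathcal I$. 3. The Poisson bialgebra $C/\mathcal I$ is a Poisson Hopf algebra whose antipode is induced by $S'$. 4. $C/\mathcal I$ is the free Poisson Hopf algebra on $B$: writing $\pi\colon C\to C/\mathcal I$ for the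 projection, for every Poisson Hopf algebra $H$ and every morphism of Poisson bialgebras $f\colon B\to H$ there is a unique morphism of Poisson Hopf algebras $g\colon C/\mathcal I\to H$ with $g\circ\pi\circ q_0=f$. -/

import Mathlib

open CategoryTheory CategoryTheory.Limits
open scoped TensorProduct

universe u v

noncomputable section

/-! ## Poisson algebras -/

/-- A Poisson algebra structure on a commutative `k`-algebra `A`: a `k`-bilinear Lie bracket `br`
each of whose hamiltonians `br a` is a derivation of the associative algebra.
(Mathlib's `LieRing A` cannot be used next to `CommRing A`: it carries its own addition.) -/
class PoissonAlgebra (k : Type*) (A : Type*) [CommRing k] [CommRing A] [Algebra k A] where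
  /-- the Poisson bracket -/
  br (k) : A →ₗ[k] A →ₗ[k] A
  br_self : ∀ a, br a a = 0
  jacobi : ∀ a b c, br a (br b c) = br (br a b) c + br b (br a c)
  leibniz : ∀ a b c, br a (b * c) = br a b * c + b * br a c

namespace PoissonAlgebra

section Basic

variable {k A : Type*} [CommRing k] [CommRing A] [Algebra k A] [PoissonAlgebra k A]

theorem br_swap (a b : A) : br k a b = - br k b a := by
  have h := br_self (k := k) (a + b)
  simp only [map_add, LinearMap.add_apply, br_self, zero_add, add_zero] at h
  exact eq_neg_of_add_eq_zero_left ((add_comm _ _).trans h)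

theorem leibniz_left (a b c : A) : br k (a * b) c = a * br k b c + br k a c * b := by
  rw [br_swap, leibniz, br_swap c a, br_swap c b]
  ring

end Basic

/-- The base ring, with its only possible Poisson bracket, zero. -/
instance self (k : Type*) [CommRing k] : PoissonAlgebra k k where
  br := 0
  br_self := by simp
  jacobi := by simp
  leibniz := by simp

section Tensor

variable (k A B : Type*) [CommRing k] [CommRing A] [Algebra k A] [PoissonAlgebra k A]
  [CommRing B] [Algebra k B] [PoissonAlgebra k B]

/-- The bilinear bracket `[p ⊗ q, r ⊗ s] = pr ⊗ [q, s] + [p, r] ⊗ qs` on `A ⊗ B`. -/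
def tensorBr : A ⊗[k] B →ₗ[k] A ⊗[k] B →ₗ[k] A ⊗[k] B :=
  TensorProduct.map₂ (LinearMap.mul k A) (br k (A := B)) +
    TensorProduct.map₂ (br k (A := A)) (LinearMap.mul k B)

variable {k A B}

theorem tensorBr_tmul (p r : A) (q s : B) :
    tensorBr k A B (p ⊗ₜ q) (r ⊗ₜ s) = (p * r) ⊗ₜ[k] br k q s + br k p r ⊗ₜ[k] (q * s) := by
  simp [tensorBr]

theorem tensorBr_swap (x y : A ⊗[k] B) : tensorBr k A B x y = - tensorBr k A B y x := by
  induction x with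
  | zero => simp
  | add x x' hx hx' => simp only [map_add, LinearMap.add_apply, hx, hx']; abel
  | tmul p q =>
    induction y with
    | zero => simp
    | add y y' hy hy' => simp only [map_add, LinearMap.add_apply, hy, hy']; abel
    | tmul r s =>
      rw [tensorBr_tmul, tensorBr_tmul, br_swap q s, br_swap p r,
        mul_comm p r, mul_comm q s, TensorProduct.tmul_neg, TensorProduct.neg_tmul]
      abel

/-- The tensor product of two Poisson algebras is a Poisson algebra. -/
instance tensor : PoissonAlgebra k (A ⊗[k] B) where
  br := tensorBr k A B
  br_self x := by
    induction x with
    | zero => simp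
    | add x y hx hy =>
      simp only [map_add, LinearMap.add_apply, hx, hy, tensorBr_swap x y]; abel
    | tmul p q => simp [tensorBr_tmul, br_self]
  jacobi x y z := by
    induction x with
    | zero => simp
    | add x x' hx hx' => simp only [map_add, LinearMap.add_apply, hx, hx']; abel
    | tmul p q =>
    induction y with
    | zero => simp
    | add y y' hy hy' => simp only [map_add, LinearMap.add_apply, hy, hy']; abel
    | tmul r s =>
    induction z with
    | zero => simp
    | add z z' hz hz' => simp only [map_add, hz, hz']; abel
    | tmul t w =>
      simp only [tensorBr_tmul, map_add, LinearMap.add_apply, leibniz, leibniz_left,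
        jacobi p r t, jacobi q s w, br_swap r p, br_swap s q, TensorProduct.tmul_add,
        TensorProduct.add_tmul, TensorProduct.tmul_neg, TensorProduct.neg_tmul, mul_neg,
        mul_comm, mul_left_comm]
      abel
  leibniz x y z := by
    induction x with
    | zero => simp
    | add x x' hx hx' =>
      simp only [map_add, LinearMap.add_apply, hx, hx', add_mul, mul_add]; abel
    | tmul p q =>
    induction y with
    | zero => simp
    | add y y' hy hy' => simp only [map_add, hy, hy', add_mul]; abel
    | tmul r s =>
    induction z with
    | zero => simp
    | add z z' hz hz' => simp only [map_add, hz, hz', mul_add]; abel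
    | tmul t w =>
      simp only [tensorBr_tmul, Algebra.TensorProduct.tmul_mul_tmul, leibniz,
        TensorProduct.tmul_add, TensorProduct.add_tmul, mul_add,
        mul_comm, mul_left_comm]
      abel

theorem br_tmul (p r : A) (q s : B) :
    br k (p ⊗ₜ[k] q) (r ⊗ₜ[k] s) = (p * r) ⊗ₜ[k] br k q s + br k p r ⊗ₜ[k] (q * s) :=
  tensorBr_tmul p r q s

theorem map_br_of {A' B' : Type*} [CommRing A'] [Algebra k A'] [PoissonAlgebra k A']
    [CommRing B'] [Algebra k B'] [PoissonAlgebra k B']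
    (f : A →ₐ[k] A') (g : B →ₐ[k] B') (hf : ∀ a b, f (br k a b) = br k (f a) (f b))
    (hg : ∀ a b, g (br k a b) = br k (g a) (g b)) (x y : A ⊗[k] B) :
    TensorProduct.map f.toLinearMap g.toLinearMap (br k x y) =
      br k (TensorProduct.map f.toLinearMap g.toLinearMap x)
        (TensorProduct.map f.toLinearMap g.toLinearMap y) := by
  induction x with
  | zero => simp
  | add x x' hx hx' => simp only [map_add, LinearMap.add_apply, hx, hx']
  | tmul p q =>
  induction y with
  | zero => simp
  | add y y' hy hy' => simp only [map_add, hy, hy']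
  | tmul r s =>
    simp only [br_tmul, map_add, TensorProduct.map_tmul, AlgHom.toLinearMap_apply, map_mul, hf, hg]

theorem comm_br (x y : A ⊗[k] A) :
    TensorProduct.comm k A A (br k x y) =
      br k (TensorProduct.comm k A A x) (TensorProduct.comm k A A y) := by
  induction x with
  | zero => simp
  | add x x' hx hx' => simp only [map_add, LinearMap.add_apply, hx, hx']
  | tmul p q =>
  induction y with
  | zero => simp
  | add y y' hy hy' => simp only [map_add, hy, hy']
  | tmul r s =>
    simp only [br_tmul, map_add, TensorProduct.comm_tmul]
    abel

end Tensor

section Ideals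

variable (k : Type*) {A : Type*} [CommRing k] [CommRing A] [Algebra k A] [PoissonAlgebra k A]

/-- A Poisson ideal: an ideal which is also a Lie ideal. -/
def IsPoissonIdeal (I : Ideal A) : Prop :=
  ∀ a : A, ∀ x ∈ I, br k a x ∈ I

/-- The Poisson ideal generated by a set: the least Poisson ideal containing it. -/
def poissonSpan (s : Set A) : Ideal A :=
  sInf {I : Ideal A | s ⊆ I ∧ IsPoissonIdeal k I}

variable {k}

/-- The bracket induced on `A ⧸ I` by a Poisson ideal `I`, as a function. -/
def quotientBr (I : Ideal A) (hI : IsPoissonIdeal k I) (x y : A ⧸ I) : A ⧸ I :=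
  Quotient.liftOn₂' x y (fun a b => Ideal.Quotient.mk I (br k a b)) (by
    intro a b a' b' ha hb
    have ha' : a - a' ∈ I := (Submodule.quotientRel_def I).1 ha
    have hb' : b - b' ∈ I := (Submodule.quotientRel_def I).1 hb
    refine Ideal.Quotient.eq.2 ?_
    have h : br k a b - br k a' b' = br k a (b - b') - br k b' (a - a') := by
      rw [map_sub, map_sub, br_swap b' a, br_swap b' a']
      ring
    rw [h]
    exact I.sub_mem (hI _ _ hb') (hI _ _ ha'))

/-- The Poisson algebra `A ⧸ I`, for a Poisson ideal `I`. -/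
@[reducible] def quotient (I : Ideal A) (hI : IsPoissonIdeal k I) : PoissonAlgebra k (A ⧸ I) where
  br := LinearMap.mk₂ k (quotientBr I hI)
    (by
      rintro ⟨a⟩ ⟨b⟩ ⟨c⟩
      exact congrArg (Ideal.Quotient.mk I) (LinearMap.map_add₂ (br k) a b c))
    (by
      rintro r ⟨a⟩ ⟨b⟩
      exact congrArg (Ideal.Quotient.mk I) (LinearMap.map_smul₂ (br k) r a b))
    (by
      rintro ⟨a⟩ ⟨b⟩ ⟨c⟩
      exact congrArg (Ideal.Quotient.mk I) (map_add (br k a) b c))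
    (by
      rintro r ⟨a⟩ ⟨b⟩
      exact congrArg (Ideal.Quotient.mk I) (map_smul (br k a) r b))
  br_self := by
    rintro ⟨a⟩
    exact congrArg (Ideal.Quotient.mk I) (br_self (k := k) a)
  jacobi := by
    rintro ⟨a⟩ ⟨b⟩ ⟨c⟩
    exact congrArg (Ideal.Quotient.mk I) (jacobi (k := k) a b c)
  leibniz := by
    rintro ⟨a⟩ ⟨b⟩ ⟨c⟩
    exact congrArg (Ideal.Quotient.mk I) (leibniz (k := k) a b c)

end Ideals

end PoissonAlgebra

open PoissonAlgebra

/-! ## Poisson bialgebras and Poisson Hopf algebras -/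

/-- A commutative bialgebra with a Poisson bracket is a Poisson bialgebra when its comultiplication
and its counit are morphisms of Poisson algebras. -/
class IsPoissonBialgebra (k : Type*) (B : Type*) [CommRing k] [CommRing B] [Bialgebra k B]
    [PoissonAlgebra k B] : Prop where
  comul_br : ∀ a b : B, Coalgebra.comul (R := k) (br k a b) =
    br k (Coalgebra.comul (R := k) a) (Coalgebra.comul (R := k) b)
  counit_br : ∀ a b : B, Coalgebra.counit (R := k) (br k a b) =
    br k (Coalgebra.counit (R := k) a) (Coalgebra.counit (R := k) b)

/-- A Poisson bialgebra over `k`. -/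
structure PoissBialgCat (k : Type u) [CommRing k] where
  /-- Bundle a Poisson bialgebra. -/
  of ::
  /-- the underlying type -/
  carrier : Type v
  [commRing : CommRing carrier]
  [bialgebra : Bialgebra k carrier]
  [poissonAlgebra : PoissonAlgebra k carrier]
  [isPoissonBialgebra : IsPoissonBialgebra k carrier]

namespace PoissBialgCat

variable {k : Type u} [CommRing k]

instance : CoeSort (PoissBialgCat.{u, v} k) (Type v) := ⟨carrier⟩

attribute [instance] commRing bialgebra poissonAlgebra isPoissonBialgebra

/-- Morphisms of Poisson bialgebras: bialgebra maps that preserve the Poisson bracket. -/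
@[ext]
structure Hom (A B : PoissBialgCat.{u, v} k) where
  /-- the underlying bialgebra map -/
  hom : A →ₐc[k] B
  map_br : ∀ a b : A, hom (br k a b) = br k (hom a) (hom b)

instance : Category (PoissBialgCat.{u, v} k) where
  Hom A B := Hom A B
  id A := ⟨.id k A, fun _ _ => rfl⟩
  comp f g := ⟨g.hom.comp f.hom, fun a b => by simp [f.map_br, g.map_br]⟩

end PoissBialgCat

/-- A Poisson Hopf algebra over `k`: a Poisson bialgebra with an antipode. -/
structure PoissHopfCat (k : Type u) [CommRing k] where
  /-- Bundle a Poisson Hopf algebra. -/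
  of ::
  /-- the underlying type -/
  carrier : Type v
  [commRing : CommRing carrier]
  [hopfAlgebra : HopfAlgebra k carrier]
  [poissonAlgebra : PoissonAlgebra k carrier]
  [isPoissonBialgebra : IsPoissonBialgebra k carrier]

namespace PoissHopfCat

variable {k : Type u} [CommRing k]

instance : CoeSort (PoissHopfCat.{u, v} k) (Type v) := ⟨carrier⟩

attribute [instance] commRing hopfAlgebra poissonAlgebra isPoissonBialgebra

/-- Morphisms of Poisson Hopf algebras: bialgebra maps that preserve the Poisson bracket and
the antipode. -/
@[ext]
structure Hom (A B : PoissHopfCat.{u, v} k) where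
  /-- the underlying bialgebra map -/
  hom : A →ₐc[k] B
  map_br : ∀ a b : A, hom (br k a b) = br k (hom a) (hom b)
  map_antipode : ∀ a : A, hom (HopfAlgebra.antipode k a) = HopfAlgebra.antipode k (hom a)

instance : Category (PoissHopfCat.{u, v} k) where
  Hom A B := Hom A B
  id A := ⟨.id k A, fun _ _ => rfl, fun _ => rfl⟩
  comp f g := ⟨g.hom.comp f.hom, fun a b => by simp [f.map_br, g.map_br],
    fun a => by simp [f.map_antipode, g.map_antipode]⟩

end PoissHopfCat

/-- The forgetful functor from Poisson Hopf algebras to Poisson bialgebras. -/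
def forgetPoissHopf (k : Type u) [CommRing k] :
    PoissHopfCat.{u, v} k ⥤ PoissBialgCat.{u, v} k where
  obj H := .of H
  map f := ⟨f.hom, f.map_br⟩

/-! ## The Poisson bialgebra `B^{op,cop}` -/

/-- A copy of `A`, to carry the opposite bracket and the co-opposite comultiplication. -/
def OpCop (A : Type*) : Type _ := A

namespace OpCop

variable (k : Type*) {A : Type*} [CommRing k] [CommRing A]

instance : CommRing (OpCop A) := inferInstanceAs (CommRing A)

section Bialgebra

variable [Bialgebra k A]

variable (A) in
/-- The co-opposite comultiplication `a ↦ a₂ ⊗ a₁`, as an algebra map on `A`. -/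
def comulCop : A →ₐ[k] A ⊗[k] A :=
  (Algebra.TensorProduct.comm k A A).toAlgHom.comp (Bialgebra.comulAlgHom k A)

theorem comulCop_apply (a : A) :
    comulCop k A a = TensorProduct.comm k A A (Coalgebra.comul a) := rfl

variable (A) in
/-- The bialgebra `A^{cop}`, on the type `A`. -/
@[reducible] def copBialgebra : Bialgebra k A :=
  .ofAlgHom (comulCop k A) (Bialgebra.counitAlgHom k A)
    (by
      let R : A ⊗[k] (A ⊗[k] A) →ₗ[k] A ⊗[k] (A ⊗[k] A) :=
        (TensorProduct.assoc k A A A).toLinearMap ∘ₗ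
          (TensorProduct.comm k A A).toLinearMap.rTensor A ∘ₗ
            (TensorProduct.comm k A (A ⊗[k] A)).toLinearMap
      have hR : ∀ a b c : A, R (a ⊗ₜ (b ⊗ₜ c)) = c ⊗ₜ (b ⊗ₜ a) := fun a b c => by simp [R]
      have h1 : ∀ t : A ⊗[k] A,
          Algebra.TensorProduct.assoc k k k A A A
            (Algebra.TensorProduct.map (comulCop k A) (.id k A) (TensorProduct.comm k A A t)) =
          R (Coalgebra.comul.lTensor A t) := fun t => by
        induction t with
        | zero => simp
        | add x y hx hy => simp only [map_add, hx, hy]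
        | tmul a b =>
          simp only [TensorProduct.comm_tmul, Algebra.TensorProduct.map_tmul, AlgHom.coe_id, id_eq,
            comulCop_apply, LinearMap.lTensor_tmul]
          induction (Coalgebra.comul b : A ⊗[k] A) with
          | zero => simp
          | add x y hx hy =>
            simp only [map_add, TensorProduct.add_tmul, TensorProduct.tmul_add, hx, hy]
          | tmul b c => simp [hR]
      have h2 : ∀ t : A ⊗[k] A,
          Algebra.TensorProduct.map (.id k A) (comulCop k A) (TensorProduct.comm k A A t) =
          R (TensorProduct.assoc k A A A (Coalgebra.comul.rTensor A t)) := fun t => by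
        induction t with
        | zero => simp
        | add x y hx hy => simp only [map_add, hx, hy]
        | tmul a b =>
          simp only [TensorProduct.comm_tmul, Algebra.TensorProduct.map_tmul, AlgHom.coe_id, id_eq,
            comulCop_apply, LinearMap.rTensor_tmul]
          induction (Coalgebra.comul a : A ⊗[k] A) with
          | zero => simp
          | add x y hx hy =>
            simp only [map_add, TensorProduct.add_tmul, TensorProduct.tmul_add, hx, hy]
          | tmul b c => simp [hR]
      refine AlgHom.ext fun a => ?_
      refine (h1 (Coalgebra.comul a)).trans (Eq.trans ?_ (h2 (Coalgebra.comul a)).symm)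
      rw [Coalgebra.coassoc_apply])
    (by
      have h : ∀ t : A ⊗[k] A,
          Algebra.TensorProduct.map (Bialgebra.counitAlgHom k A) (.id k A)
            (TensorProduct.comm k A A t) =
          TensorProduct.comm k A k (Coalgebra.counit.lTensor A t) := fun t => by
        induction t with
        | zero => simp
        | add x y hx hy => simp only [map_add, hx, hy]
        | tmul a b => simp
      refine AlgHom.ext fun a => (h (Coalgebra.comul a)).trans ?_
      rw [Coalgebra.lTensor_counit_comul]
      simp)
    (by
      have h : ∀ t : A ⊗[k] A,
          Algebra.TensorProduct.map (.id k A) (Bialgebra.counitAlgHom k A)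
            (TensorProduct.comm k A A t) =
          TensorProduct.comm k k A (Coalgebra.counit.rTensor A t) := fun t => by
        induction t with
        | zero => simp
        | add x y hx hy => simp only [map_add, hx, hy]
        | tmul a b => simp
      refine AlgHom.ext fun a => (h (Coalgebra.comul a)).trans ?_
      rw [Coalgebra.rTensor_counit_comul]
      simp)

instance : Bialgebra k (OpCop A) := copBialgebra k A

variable (A) in
/-- The identity map `A → A^{op,cop}`; it is an algebra isomorphism, because `A` is commutative. -/
def equiv : A ≃ₐ[k] OpCop A :=
  (AlgEquiv.refl : A ≃ₐ[k] A)

end Bialgebra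

variable (A) in
/-- The opposite bracket `[a, b]^{op} = [b, a]`, on the type `A`. -/
@[reducible] def opPoissonAlgebra [Algebra k A] [PoissonAlgebra k A] : PoissonAlgebra k A where
  br := (br k (A := A)).flip
  br_self a := br_self (k := k) a
  jacobi a b c := by
    simp only [LinearMap.flip_apply]
    rw [jacobi (k := k) c b a, br_swap (br k c a) b]
    abel
  leibniz a b c := by
    simp only [LinearMap.flip_apply]
    rw [leibniz_left]
    ring

variable [Bialgebra k A]

theorem comul_equiv (a : A) : Coalgebra.comul (R := k) (equiv k A a) =
    TensorProduct.map (equiv k A).toLinearMap (equiv k A).toLinearMap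
      (TensorProduct.comm k A A (Coalgebra.comul a)) := by
  exact (LinearMap.congr_fun (TensorProduct.map_id (R := k) (M := A) (N := A)) _).symm

theorem counit_equiv (a : A) :
    Coalgebra.counit (R := k) (equiv k A a) = Coalgebra.counit (R := k) a := rfl

variable [PoissonAlgebra k A]

instance : PoissonAlgebra k (OpCop A) := opPoissonAlgebra k A

theorem br_equiv (a b : A) :
    br k (equiv k A a) (equiv k A b) = equiv k A (br k b a) := rfl

instance [IsPoissonBialgebra k A] : IsPoissonBialgebra k (OpCop A) where
  comul_br a b := by
    obtain ⟨a, rfl⟩ := (equiv k A).surjective a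
    obtain ⟨b, rfl⟩ := (equiv k A).surjective b
    have key : ∀ x y : A ⊗[k] A,
        TensorProduct.map (equiv k A).toLinearMap (equiv k A).toLinearMap (br k x y) =
          br k (TensorProduct.map (equiv k A).toLinearMap (equiv k A).toLinearMap y)
            (TensorProduct.map (equiv k A).toLinearMap (equiv k A).toLinearMap x) := by
      intro x y
      induction x with
      | zero => simp
      | add x x' hx hx' => simp only [map_add, LinearMap.add_apply, hx, hx']
      | tmul p q =>
      induction y with
      | zero => simp
      | add y y' hy hy' => simp only [map_add, LinearMap.add_apply, hy, hy']
      | tmul r s =>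
        simp only [br_tmul, map_add, TensorProduct.map_tmul, AlgEquiv.toLinearMap_apply, map_mul,
          br_equiv, mul_comm]
    rw [br_equiv, comul_equiv, comul_equiv, comul_equiv, IsPoissonBialgebra.comul_br, comm_br, key]
  counit_br a b := by
    obtain ⟨a, rfl⟩ := (equiv k A).surjective a
    obtain ⟨b, rfl⟩ := (equiv k A).surjective b
    rw [br_equiv, counit_equiv, counit_equiv, counit_equiv, IsPoissonBialgebra.counit_br]
    rfl

end OpCop

namespace PoissBialgCat

variable {k : Type u} [CommRing k]

/-- The Poisson bialgebra `B^{op,cop}`: the algebra of `B` with the opposite bracket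
and the co-opposite comultiplication. -/
def opCop (B : PoissBialgCat.{u, v} k) : PoissBialgCat.{u, v} k := .of (OpCop B)

/-- The copies `B₀ = B`, `B₁ = B^{op,cop}`, `B₂ = B`, `B₃ = B^{op,cop}`, … -/
def altCopy (B : PoissBialgCat.{u, v} k) : ℕ → PoissBialgCat.{u, v} k
  | 0 => B
  | 1 => B.opCop
  | n + 2 => altCopy B n

/-- The identity map `B → Bₙ`. -/
def toCopy (B : PoissBialgCat.{u, v} k) : ∀ n, B ≃ₐ[k] B.altCopy n
  | 0 => AlgEquiv.refl
  | 1 => OpCop.equiv k B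
  | n + 2 => toCopy B n

/-- The linear map `C → C` underlying a morphism `S : C → C^{op,cop}`. -/
def endo {C : PoissBialgCat.{u, v} k} (S : C ⟶ C.opCop) : C →ₗ[k] C :=
  (OpCop.equiv k C).symm.toLinearMap ∘ₗ S.hom.toCoalgHom.toLinearMap

/-- For a linear endomorphism `S` of `C`, the linear map `S * Id - u ∘ ε` of `C`, where `*` is the
convolution product and `u ∘ ε` its unit. -/
def leftDefect {C : PoissBialgCat.{u, v} k} (S : C →ₗ[k] C) : C →ₗ[k] C :=
  (WithConv.toConv S * WithConv.toConv LinearMap.id - 1).ofConv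

/-- The linear map `Id * S - u ∘ ε` of `C`. -/
def rightDefect {C : PoissBialgCat.{u, v} k} (S : C →ₗ[k] C) : C →ₗ[k] C :=
  (WithConv.toConv LinearMap.id * WithConv.toConv S - 1).ofConv

/-- The Poisson ideal of `C` generated by the elements `(S * Id - u ∘ ε)(qₙ(x))` and
`(Id * S - u ∘ ε)(qₙ(x))` for `x ∈ Bₙ`, `n ∈ ℕ`. -/
def antipodeIdeal {D : ℕ → PoissBialgCat.{u, v} k} {C : PoissBialgCat.{u, v} k}
    (q : ∀ n, D n ⟶ C) (S : C →ₗ[k] C) : Ideal C :=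
  poissonSpan k {y : C | ∃ (n : ℕ) (x : D n),
    y = leftDefect S ((q n).hom x) ∨ y = rightDefect S ((q n).hom x)}

/-- A Poisson ideal `I` of `C` is a Hopf ideal relative to a linear map `S : C → C` when
`ε(I) = 0`, `Δ(I) ⊆ C ⊗ I + I ⊗ C` and `S(I) ⊆ I`. -/
structure IsPoissonHopfIdeal {C : PoissBialgCat.{u, v} k} (I : Ideal C) (S : C →ₗ[k] C) :
    Prop where
  isPoissonIdeal : IsPoissonIdeal k I
  counit_eq_zero : ∀ x ∈ I, Coalgebra.counit (R := k) x = 0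
  comul_mem : ∀ x ∈ I, Coalgebra.comul (R := k) x ∈
    LinearMap.range (LinearMap.lTensor C (I.restrictScalars k).subtype) ⊔
      LinearMap.range (LinearMap.rTensor C (I.restrictScalars k).subtype)
  map_mem : ∀ x ∈ I, S x ∈ I

/-- `S` is an antipode modulo `I`: both `S * Id` and `Id * S` agree with `u ∘ ε` modulo `I`. -/
structure IsAntipodeMod {C : PoissBialgCat.{u, v} k} (I : Ideal C) (S : C →ₗ[k] C) : Prop where
  left_mem : ∀ x, leftDefect S x ∈ I
  right_mem : ∀ x, rightDefect S x ∈ I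

section Quotient

variable {C : PoissBialgCat.{u, v} k} {I : Ideal C} {S : C →ₗ[k] C}

theorem IsPoissonHopfIdeal.isCoideal (h : IsPoissonHopfIdeal I S) :
    (I.restrictScalars k).IsCoideal :=
  (Submodule.isCoideal_iff_comul_mem _).2 ⟨h.counit_eq_zero, h.comul_mem⟩

/-- The linear map induced by `S` on `C ⧸ I`. -/
def quotientMap (h : IsPoissonHopfIdeal I S) : (C ⧸ I) →ₗ[k] (C ⧸ I) :=
  Submodule.mapQ (I.restrictScalars k) (I.restrictScalars k) S h.map_mem

theorem mul_map_quotient_left (h : IsPoissonHopfIdeal I S) (t : C ⊗[k] C) :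
    LinearMap.mul' k (C ⧸ I) (TensorProduct.map (quotientMap h) .id
      (TensorProduct.map (Ideal.Quotient.mkₐ k I).toLinearMap
        (Ideal.Quotient.mkₐ k I).toLinearMap t)) =
      Ideal.Quotient.mk I (LinearMap.mul' k C (TensorProduct.map S .id t)) := by
  induction t with
  | zero => simp
  | add x y hx hy => simp only [map_add, hx, hy]
  | tmul a b => rfl

theorem mul_map_quotient_right (h : IsPoissonHopfIdeal I S) (t : C ⊗[k] C) :
    LinearMap.mul' k (C ⧸ I) (TensorProduct.map .id (quotientMap h)
      (TensorProduct.map (Ideal.Quotient.mkₐ k I).toLinearMap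
        (Ideal.Quotient.mkₐ k I).toLinearMap t)) =
      Ideal.Quotient.mk I (LinearMap.mul' k C (TensorProduct.map .id S t)) := by
  induction t with
  | zero => simp
  | add x y hx hy => simp only [map_add, hx, hy]
  | tmul a b => rfl

/-- The Hopf algebra `C ⧸ I`, with the bialgebra structure induced by that of `C` and the antipode
induced by `S`. -/
@[reducible] def quotientHopf (h : IsPoissonHopfIdeal I S) (h' : IsAntipodeMod I S) :
    HopfAlgebra k (C ⧸ I) :=
  haveI := h.isCoideal
  .ofConvInverse (quotientMap h)
    (by
      refine WithConv.ext (LinearMap.ext ?_)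
      rintro ⟨x⟩
      exact (mul_map_quotient_left h _).trans (Ideal.Quotient.eq.2 (h'.left_mem x)))
    (by
      refine WithConv.ext (LinearMap.ext ?_)
      rintro ⟨x⟩
      exact (mul_map_quotient_right h _).trans (Ideal.Quotient.eq.2 (h'.right_mem x)))

variable (I S) in
/-- The Poisson Hopf algebra `C ⧸ I`: bracket, multiplication, comultiplication and counit are
induced by those of `C`, and the antipode by `S`. -/
def quotient (h : IsPoissonHopfIdeal I S) (h' : IsAntipodeMod I S) : PoissHopfCat.{u, v} k :=
  letI := quotientHopf h h'
  letI := PoissonAlgebra.quotient I h.isPoissonIdeal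
  haveI : IsPoissonBialgebra k (C ⧸ I) :=
    { comul_br := by
        rintro ⟨a⟩ ⟨b⟩
        refine (congrArg (TensorProduct.map (Ideal.Quotient.mkₐ k I).toLinearMap
          (Ideal.Quotient.mkₐ k I).toLinearMap)
            (IsPoissonBialgebra.comul_br (k := k) a b)).trans ?_
        exact map_br_of (Ideal.Quotient.mkₐ k I) (Ideal.Quotient.mkₐ k I)
          (fun _ _ => rfl) (fun _ _ => rfl) _ _
      counit_br := by
        rintro ⟨a⟩ ⟨b⟩
        exact IsPoissonBialgebra.counit_br (k := k) a b }
  .of (C ⧸ I)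

variable (I S) in
/-- The projection `C → C ⧸ I`. -/
def toQuotient (h : IsPoissonHopfIdeal I S) (h' : IsAntipodeMod I S) :
    C ⟶ (forgetPoissHopf k).obj (quotient I S h h') :=
  haveI := h.isCoideal
  ⟨Bialgebra.Quotient.mkBialgHom I, fun _ _ => rfl⟩

theorem toQuotient_apply (h : IsPoissonHopfIdeal I S) (h' : IsAntipodeMod I S) (x : C) :
    (toQuotient I S h h').hom x = Ideal.Quotient.mk I x := rfl

theorem quotient_antipode_mk (h : IsPoissonHopfIdeal I S) (h' : IsAntipodeMod I S) (x : C) :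
    HopfAlgebra.antipode k (A := quotient I S h h') ((toQuotient I S h h').hom x) =
      (toQuotient I S h h').hom (S x) := rfl

end Quotient

end PoissBialgCat

end

/-! In a Poisson Hopf algebra `H` the antipode `S` reverses the bracket and the comultiplication
(`antipode_br`, `comul_antipode`), so it is a morphism `H → H^{op,cop}`. A morphism `f : B → H`
therefore produces morphisms `Sⁿ ∘ f` out of `Bₙ` for every `n`. The free object must contain all
these images: in the coproduct `C` the element `qₙ(b)` stands for `Sⁿ(b)`, the shift `S'` plays the
antipode, and the ideal `I` imposes the antipode axioms.

The axioms are imposed only on the elements `qₙ(x)`, and the work is to show that this suffices.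
Three mechanisms do it.

Modulo `I`, the identity `S' * Id = u ∘ ε` spreads from the `qₙ(x)` to all of `C`. It is stable
under products because convolution products of algebra maps into a commutative algebra are algebra
maps. It is stable under brackets because in `xz[y,w] - [x,z]yw` the Leibniz rule turns everything
into brackets with `xy` and `zw`, which vanish when those are scalars (`mul_br_sub_br_mul`,
`convMul_br_eq`).

The comultiplication respects `I` because convolution inverses pass to tensor squares
(`map_comm_comul_mul`, `map_comul_mul`): the generators die in `C/I ⊗ C/I`, and the kernel of the
Poisson map `C → C/I ⊗ C/I` is a Poisson ideal.

The shift preserves `I` because it exchanges `S' * Id` with `Id * S'` and `qₙ` with `qₙ₊₁`; this is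
why both families of relations are imposed, for all `n`.

Fullness of the forgetful functor is the uniqueness of convolution inverses
(`map_antipode_of_bialgHom`). The coproduct itself is a quotient of formal expressions, and its `Δ`
and `ε` come from its universal property among Poisson algebras. -/

noncomputable section

open PoissonAlgebra

/-! ## Coproducts of Poisson algebras -/

namespace PoissonAlgebra

/-- Formal expressions in the elements of a family of Poisson algebras. -/
inductive CoprodTerm (k : Type*) {ι : Type*} (A : ι → Type*)
  | of (i : ι) (a : A i)
  | const (r : k)
  | add (x y : CoprodTerm k A)
  | mul (x y : CoprodTerm k A)
  | bracket (x y : CoprodTerm k A)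

section Coprod

variable (k : Type*) {ι : Type*} (A : ι → Type*) [CommRing k] [∀ i, CommRing (A i)]
  [∀ i, Algebra k (A i)] [∀ i, PoissonAlgebra k (A i)]

open CoprodTerm in
/-- The relations that make the formal expressions into the coproduct of Poisson algebras. -/
inductive CoprodRel : CoprodTerm k A → CoprodTerm k A → Prop
  | of_add (i : ι) (a b : A i) : CoprodRel (of i (a + b)) (add (of i a) (of i b))
  | of_mul (i : ι) (a b : A i) : CoprodRel (of i (a * b)) (mul (of i a) (of i b))
  | of_algebraMap (i : ι) (r : k) : CoprodRel (of i (algebraMap k (A i) r)) (const r)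
  | of_br (i : ι) (a b : A i) :
    CoprodRel (of i (PoissonAlgebra.br k a b)) (bracket (of i a) (of i b))
  | const_add (r s : k) : CoprodRel (const (r + s)) (add (const r) (const s))
  | const_mul (r s : k) : CoprodRel (const (r * s)) (mul (const r) (const s))
  | add_comm x y : CoprodRel (add x y) (add y x)
  | add_assoc x y z : CoprodRel (add (add x y) z) (add x (add y z))
  | zero_add x : CoprodRel (add (const 0) x) x
  | mul_comm x y : CoprodRel (mul x y) (mul y x)
  | mul_assoc x y z : CoprodRel (mul (mul x y) z) (mul x (mul y z))
  | one_mul x : CoprodRel (mul (const 1) x) x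
  | zero_mul x : CoprodRel (mul (const 0) x) (const 0)
  | mul_add x y z : CoprodRel (mul x (add y z)) (add (mul x y) (mul x z))
  | br_add x y z : CoprodRel (bracket x (add y z)) (add (bracket x y) (bracket x z))
  | add_br x y z : CoprodRel (bracket (add x y) z) (add (bracket x z) (bracket y z))
  | br_smul r x y : CoprodRel (bracket x (mul (const r) y)) (mul (const r) (bracket x y))
  | smul_br r x y : CoprodRel (bracket (mul (const r) x) y) (mul (const r) (bracket x y))
  | br_self x : CoprodRel (bracket x x) (const 0)
  | jacobi x y z : CoprodRel (bracket x (bracket y z)) <|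
    add (bracket (bracket x y) z) (bracket y (bracket x z))
  | leibniz x y z : CoprodRel (bracket x (mul y z)) <|
    add (mul (bracket x y) z) (mul y (bracket x z))
  -- These congruences, one argument at a time, let the operations descend to the quotient. `Quot`
  -- itself supplies the equivalence closure.
  | add_left x x' y : CoprodRel x x' → CoprodRel (add x y) (add x' y)
  | add_right x y y' : CoprodRel y y' → CoprodRel (add x y) (add x y')
  | mul_left x x' y : CoprodRel x x' → CoprodRel (mul x y) (mul x' y)
  | mul_right x y y' : CoprodRel y y' → CoprodRel (mul x y) (mul x y')
  | br_left x x' y : CoprodRel x x' → CoprodRel (bracket x y) (bracket x' y)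
  | br_right x y y' : CoprodRel y y' → CoprodRel (bracket x y) (bracket x y')

/-- The coproduct of a family of Poisson algebras. -/
def Coprod : Type _ := Quot (CoprodRel k A)

namespace Coprod

open CoprodRel

instance : Add (Coprod k A) :=
  ⟨Quot.map₂ .add (fun x y y' h => add_right x y y' h) (fun x x' y h => add_left x x' y h)⟩

instance : Mul (Coprod k A) :=
  ⟨Quot.map₂ .mul (fun x y y' h => mul_right x y y' h) (fun x x' y h => mul_left x x' y h)⟩

/-- The scalars of the coproduct. -/
def const (r : k) : Coprod k A := Quot.mk _ (.const r)

instance : Zero (Coprod k A) := ⟨const k A 0⟩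

instance : One (Coprod k A) := ⟨const k A 1⟩

/-- Negation is not a formal operation: multiplication by the scalar `-1` already provides it. -/
instance : Neg (Coprod k A) := ⟨fun x => const k A (-1) * x⟩

/-- The bracket of the coproduct, as a function. -/
def brFun : Coprod k A → Coprod k A → Coprod k A :=
  Quot.map₂ .bracket (fun x y y' h => br_right x y y' h) (fun x x' y h => br_left x x' y h)

variable {k A}

theorem mul_add' (x y z : Coprod k A) : x * (y + z) = x * y + x * z := by
  rcases x with ⟨x⟩; rcases y with ⟨y⟩; rcases z with ⟨z⟩
  exact Quot.sound (CoprodRel.mul_add x y z)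

theorem mul_comm' (x y : Coprod k A) : x * y = y * x := by
  rcases x with ⟨x⟩; rcases y with ⟨y⟩
  exact Quot.sound (CoprodRel.mul_comm x y)

theorem add_comm' (x y : Coprod k A) : x + y = y + x := by
  rcases x with ⟨x⟩; rcases y with ⟨y⟩
  exact Quot.sound (CoprodRel.add_comm x y)

theorem zero_add' (x : Coprod k A) : 0 + x = x := by
  rcases x with ⟨x⟩
  exact Quot.sound (CoprodRel.zero_add x)

theorem one_mul' (x : Coprod k A) : 1 * x = x := by
  rcases x with ⟨x⟩
  exact Quot.sound (CoprodRel.one_mul x)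

theorem zero_mul' (x : Coprod k A) : 0 * x = 0 := by
  rcases x with ⟨x⟩
  exact Quot.sound (CoprodRel.zero_mul x)

theorem neg_add_cancel' (x : Coprod k A) : -x + x = 0 := by
  have h : const k A (-1) + const k A 1 = 0 := by
    refine (Quot.sound (CoprodRel.const_add (-1 : k) 1)).symm.trans ?_
    rw [neg_add_cancel]
    rfl
  calc -x + x = const k A (-1) * x + 1 * x := by rw [one_mul']; rfl
    _ = 0 := by
      rw [mul_comm', mul_comm' 1, ← mul_add']
      exact (congrArg (x * ·) h).trans ((mul_comm' x 0).trans (zero_mul' x))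

instance : CommRing (Coprod k A) where
  add_assoc := by
    rintro ⟨x⟩ ⟨y⟩ ⟨z⟩
    exact Quot.sound (CoprodRel.add_assoc x y z)
  zero_add := zero_add'
  add_zero x := (add_comm' x 0).trans (zero_add' x)
  add_comm := add_comm'
  neg_add_cancel := neg_add_cancel'
  nsmul := nsmulRec
  zsmul := zsmulRec
  mul_assoc := by
    rintro ⟨x⟩ ⟨y⟩ ⟨z⟩
    exact Quot.sound (CoprodRel.mul_assoc x y z)
  mul_comm := mul_comm'
  one_mul := one_mul'
  mul_one x := (mul_comm' x 1).trans (one_mul' x)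
  zero_mul := zero_mul'
  mul_zero x := (mul_comm' x 0).trans (zero_mul' x)
  left_distrib := mul_add'
  right_distrib x y z := by rw [mul_comm', mul_add', mul_comm' z, mul_comm' z]

instance : Algebra k (Coprod k A) :=
  RingHom.toAlgebra
    { toFun := const k A
      map_zero' := rfl
      map_one' := rfl
      map_add' := fun r s => Quot.sound (CoprodRel.const_add r s)
      map_mul' := fun r s => Quot.sound (CoprodRel.const_mul r s) }

instance : PoissonAlgebra k (Coprod k A) where
  br := LinearMap.mk₂ k (brFun k A)
    (by
      rintro ⟨x⟩ ⟨y⟩ ⟨z⟩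
      exact Quot.sound (CoprodRel.add_br x y z))
    (by
      rintro r ⟨x⟩ ⟨y⟩
      exact Quot.sound (CoprodRel.smul_br r x y))
    (by
      rintro ⟨x⟩ ⟨y⟩ ⟨z⟩
      exact Quot.sound (CoprodRel.br_add x y z))
    (by
      rintro r ⟨x⟩ ⟨y⟩
      exact Quot.sound (CoprodRel.br_smul r x y))
  br_self := by
    rintro ⟨x⟩
    exact Quot.sound (CoprodRel.br_self x)
  jacobi := by
    rintro ⟨x⟩ ⟨y⟩ ⟨z⟩
    exact Quot.sound (CoprodRel.jacobi x y z)
  leibniz := by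
    rintro ⟨x⟩ ⟨y⟩ ⟨z⟩
    exact Quot.sound (CoprodRel.leibniz x y z)

variable (k A) in
/-- The injections into the coproduct. -/
def of (i : ι) : A i →ₐ[k] Coprod k A where
  toFun a := Quot.mk _ (.of i a)
  map_zero' := by
    rw [← map_zero (algebraMap k (A i))]
    exact Quot.sound (CoprodRel.of_algebraMap i 0)
  map_one' := by
    rw [← map_one (algebraMap k (A i))]
    exact Quot.sound (CoprodRel.of_algebraMap i 1)
  map_add' a b := Quot.sound (CoprodRel.of_add i a b)
  map_mul' a b := Quot.sound (CoprodRel.of_mul i a b)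
  commutes' r := Quot.sound (CoprodRel.of_algebraMap i r)

theorem of_br (i : ι) (a b : A i) : of k A i (br k a b) = br k (of k A i a) (of k A i b) :=
  Quot.sound (CoprodRel.of_br i a b)

/-- The coproduct is generated by the images of the injections. -/
theorem induction {p : Coprod k A → Prop} (x : Coprod k A) (of : ∀ i a, p (of k A i a))
    (algebraMap : ∀ r : k, p (algebraMap k _ r)) (add : ∀ x y, p x → p y → p (x + y))
    (mul : ∀ x y, p x → p y → p (x * y)) (br : ∀ x y, p x → p y → p (br k x y)) : p x := by
  rcases x with ⟨x⟩
  induction x with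
  | of i a => exact of i a
  | const r => exact algebraMap r
  | add x y hx hy => exact add _ _ hx hy
  | mul x y hx hy => exact mul _ _ hx hy
  | bracket x y hx hy => exact br _ _ hx hy

variable {Q : Type*} [CommRing Q] [Algebra k Q] [PoissonAlgebra k Q]

theorem hom_ext {f g : Coprod k A →ₐ[k] Q} (hf : ∀ x y, f (br k x y) = br k (f x) (f y))
    (hg : ∀ x y, g (br k x y) = br k (g x) (g y))
    (h : ∀ i a, f (of k A i a) = g (of k A i a)) : f = g := by
  refine AlgHom.ext fun x => ?_
  induction x using induction with
  | of i a => exact h i a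
  | algebraMap r => simp
  | add x y hx hy => simp [hx, hy]
  | mul x y hx hy => simp [hx, hy]
  | br x y hx hy => rw [hf, hg, hx, hy]

/-- The evaluation of formal expressions in a Poisson algebra. -/
def eval (f : ∀ i, A i →ₐ[k] Q) : CoprodTerm k A → Q
  | .of i a => f i a
  | .const r => algebraMap k Q r
  | .add x y => eval f x + eval f y
  | .mul x y => eval f x * eval f y
  | .bracket x y => br k (eval f x) (eval f y)

/-- Each relation is an axiom of Poisson algebras, a compatibility of `f i`, or a congruence, so it
holds after evaluation in any Poisson algebra. -/
theorem eval_eq_of_rel (f : ∀ i, A i →ₐ[k] Q)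
    (hf : ∀ i a b, f i (br k a b) = br k (f i a) (f i b)) {x y : CoprodTerm k A}
    (h : CoprodRel k A x y) : eval f x = eval f y := by
  induction h with
  | of_add | of_mul | const_add | const_mul | br_add | add_br => simp [eval]
  | of_algebraMap | zero_add | one_mul | zero_mul => simp [eval]
  | of_br => simp [eval, hf]
  | add_comm | add_assoc | mul_comm | mul_assoc | mul_add => simp only [eval]; ring
  | br_smul | smul_br => simp [eval, ← Algebra.smul_def]
  | br_self => simp [eval, PoissonAlgebra.br_self]
  | jacobi => exact PoissonAlgebra.jacobi _ _ _
  | leibniz => exact PoissonAlgebra.leibniz _ _ _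
  | add_left _ _ _ _ h | add_right _ _ _ _ h | mul_left _ _ _ _ h | mul_right _ _ _ _ h
  | br_left _ _ _ _ h | br_right _ _ _ _ h => simp only [eval, h]

/-- The universal property of the coproduct of Poisson algebras. -/
def lift (f : ∀ i, A i →ₐ[k] Q) (hf : ∀ i a b, f i (br k a b) = br k (f i a) (f i b)) :
    Coprod k A →ₐ[k] Q where
  toFun := Quot.lift (eval f) fun _ _ h => eval_eq_of_rel f hf h
  map_zero' := map_zero (algebraMap k Q)
  map_one' := map_one (algebraMap k Q)
  map_add' := by rintro ⟨x⟩ ⟨y⟩; rfl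
  map_mul' := by rintro ⟨x⟩ ⟨y⟩; rfl
  commutes' _ := rfl

variable (f : ∀ i, A i →ₐ[k] Q) (hf : ∀ i a b, f i (br k a b) = br k (f i a) (f i b))

theorem lift_br (x y : Coprod k A) :
    lift f hf (br k x y) = br k (lift f hf x) (lift f hf y) := by
  rcases x with ⟨x⟩; rcases y with ⟨y⟩; rfl

end Coprod

end Coprod

end PoissonAlgebra

/-! ## Coproducts of Poisson bialgebras -/

namespace PoissonAlgebra

section

variable {k A B A' B' : Type*} [CommRing k] [CommRing A] [Algebra k A] [PoissonAlgebra k A]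
  [CommRing B] [Algebra k B] [PoissonAlgebra k B]
  [CommRing A'] [Algebra k A'] [PoissonAlgebra k A']
  [CommRing B'] [Algebra k B'] [PoissonAlgebra k B']

theorem tensorMap_br (f : A →ₐ[k] A') (g : B →ₐ[k] B')
    (hf : ∀ a b, f (br k a b) = br k (f a) (f b))
    (hg : ∀ a b, g (br k a b) = br k (g a) (g b)) (x y : A ⊗[k] B) :
    Algebra.TensorProduct.map f g (br k x y) =
      br k (Algebra.TensorProduct.map f g x) (Algebra.TensorProduct.map f g y) :=
  map_br_of f g hf hg x y

/-- The Leibniz rule at `1 * 1` gives `[a,1] = [a,1] + [a,1]`, so scalars are central for the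
bracket. -/
theorem br_algebraMap (a : A) (r : k) : br k a (algebraMap k A r) = 0 := by
  have h := leibniz (k := k) a (1 : A) 1
  rw [Algebra.algebraMap_eq_smul_one, map_smul]
  simp only [mul_one, one_mul, left_eq_add] at h
  rw [h, smul_zero]

theorem algebraMap_br (a : A) (r : k) : br k (algebraMap k A r) a = 0 := by
  rw [br_swap, br_algebraMap, neg_zero]

theorem assoc_br (x y : (A ⊗[k] B) ⊗[k] A') :
    TensorProduct.assoc k A B A' (br k x y) =
      br k (TensorProduct.assoc k A B A' x) (TensorProduct.assoc k A B A' y) := by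
  induction x with
  | zero => simp
  | add x x' hx hx' => simp only [map_add, LinearMap.add_apply, hx, hx']
  | tmul p c =>
  induction p with
  | zero => simp
  | add x x' hx hx' => simp only [map_add, TensorProduct.add_tmul, LinearMap.add_apply, hx, hx']
  | tmul a b =>
  induction y with
  | zero => simp
  | add y y' hy hy' => simp only [map_add, hy, hy']
  | tmul q c' =>
  induction q with
  | zero => simp
  | add x x' hx hx' => simp only [map_add, TensorProduct.add_tmul, hx, hx']
  | tmul a' b' =>
    simp only [br_tmul, TensorProduct.assoc_tmul, Algebra.TensorProduct.tmul_mul_tmul, map_add,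
      TensorProduct.add_tmul, TensorProduct.tmul_add]
    abel

end

/-! ### The bialgebra structure of the coproduct of Poisson algebras. -/

namespace Coprod

variable (k : Type*) {ι : Type*} (A : ι → Type*) [CommRing k] [∀ i, CommRing (A i)]
  [∀ i, Bialgebra k (A i)] [∀ i, PoissonAlgebra k (A i)] [∀ i, IsPoissonBialgebra k (A i)]

/-- The comultiplication of the coproduct. -/
def comulHom : Coprod k A →ₐ[k] Coprod k A ⊗[k] Coprod k A :=
  lift (fun i => (Algebra.TensorProduct.map (of k A i) (of k A i)).comp
      (Bialgebra.comulAlgHom k (A i))) fun i a b => by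
    simp only [AlgHom.comp_apply, Bialgebra.comulAlgHom_apply, IsPoissonBialgebra.comul_br]
    exact tensorMap_br _ _ (of_br i) (of_br i) _ _

/-- The counit of the coproduct. -/
def counitHom : Coprod k A →ₐ[k] k :=
  lift (fun i => Bialgebra.counitAlgHom k (A i)) fun _ => IsPoissonBialgebra.counit_br

variable {A}

theorem comulHom_of (i : ι) (a : A i) : comulHom k A (of k A i a) =
    Algebra.TensorProduct.map (of k A i) (of k A i) (Coalgebra.comul (R := k) a) := rfl

theorem counitHom_of (i : ι) (a : A i) :
    counitHom k A (of k A i a) = Coalgebra.counit (R := k) a := rfl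

theorem comulHom_br (x y : Coprod k A) :
    comulHom k A (br k x y) = br k (comulHom k A x) (comulHom k A y) :=
  lift_br _ _ x y

theorem counitHom_br (x y : Coprod k A) :
    counitHom k A (br k x y) = br k (counitHom k A x) (counitHom k A y) :=
  lift_br _ _ x y

-- Both sides preserve the bracket, so `hom_ext` reduces the identity to a single `A i`, where it is
-- the coassociativity of `A i` carried along the injection. The counit laws below follow the same
-- pattern.
variable (A) in
theorem comulHom_coassoc : (Algebra.TensorProduct.assoc k k k _ _ _).toAlgHom.comp
      ((Algebra.TensorProduct.map (comulHom k A) (.id k _)).comp (comulHom k A)) =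
    (Algebra.TensorProduct.map (.id k _) (comulHom k A)).comp (comulHom k A) := by
  refine hom_ext (fun x y => ?_) (fun x y => ?_) fun i a => ?_
  · simp only [AlgHom.comp_apply, comulHom_br]
    rw [tensorMap_br _ _ (comulHom_br k) (fun _ _ => rfl)]
    exact assoc_br _ _
  · simp only [AlgHom.comp_apply, comulHom_br]
    exact tensorMap_br _ _ (fun _ _ => rfl) (comulHom_br k) _ _
  · let F := of k A i
    have h1 : ∀ t : A i ⊗[k] A i, TensorProduct.assoc k _ _ _
        (Algebra.TensorProduct.map (comulHom k A) (.id k _) (Algebra.TensorProduct.map F F t)) =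
        Algebra.TensorProduct.map F (Algebra.TensorProduct.map F F)
          (TensorProduct.assoc k _ _ _ (Coalgebra.comul.rTensor (A i) t)) := fun t => by
      induction t with
      | zero => simp
      | add x y hx hy => simp only [map_add, hx, hy]
      | tmul a b =>
        simp only [Algebra.TensorProduct.map_tmul, F, comulHom_of, LinearMap.rTensor_tmul,
          AlgHom.id_apply]
        induction (Coalgebra.comul a : A i ⊗[k] A i) with
        | zero => simp
        | add x y hx hy => simp only [map_add, TensorProduct.add_tmul, hx, hy]
        | tmul c d => simp
    have h2 : ∀ t : A i ⊗[k] A i,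
        Algebra.TensorProduct.map (.id k _) (comulHom k A) (Algebra.TensorProduct.map F F t) =
        Algebra.TensorProduct.map F (Algebra.TensorProduct.map F F)
          (Coalgebra.comul.lTensor (A i) t) := fun t => by
      induction t with
      | zero => simp
      | add x y hx hy => simp only [map_add, hx, hy]
      | tmul a b => simp [F, comulHom_of]
    refine (h1 (Coalgebra.comul a)).trans (Eq.trans ?_ (h2 (Coalgebra.comul a)).symm)
    rw [Coalgebra.coassoc_apply]

variable (A) in
theorem counitHom_comp_comulHom_left :
    (Algebra.TensorProduct.map (counitHom k A) (.id k _)).comp (comulHom k A) =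
      (Algebra.TensorProduct.lid k (Coprod k A)).symm := by
  refine hom_ext (fun x y => ?_) (fun x y => ?_) fun i a => ?_
  · simp only [AlgHom.comp_apply, comulHom_br]
    exact tensorMap_br _ _ (counitHom_br k) (fun _ _ => rfl) _ _
  -- In `k ⊗ C` the second summand of the bracket contains `[1,1] = 0`, so `x ↦ 1 ⊗ x` preserves the
  -- bracket.
  · change (1 : k) ⊗ₜ[k] br k x y = br k ((1 : k) ⊗ₜ[k] x) ((1 : k) ⊗ₜ[k] y)
    rw [br_tmul, br_self, TensorProduct.zero_tmul, add_zero, mul_one]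
  · have h : ∀ t : A i ⊗[k] A i, Algebra.TensorProduct.map (counitHom k A) (.id k _)
        (Algebra.TensorProduct.map (of k A i) (of k A i) t) =
        Algebra.TensorProduct.map (.id k k) (of k A i) (Coalgebra.counit.rTensor (A i) t) :=
      fun t => by
        induction t with
        | zero => simp
        | add x y hx hy => simp only [map_add, hx, hy]
        | tmul a b => simp [counitHom_of]
    refine (h (Coalgebra.comul a)).trans ?_
    rw [Coalgebra.rTensor_counit_comul]
    rfl

variable (A) in
theorem counitHom_comp_comulHom_right :
    (Algebra.TensorProduct.map (.id k _) (counitHom k A)).comp (comulHom k A) =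
      (Algebra.TensorProduct.rid k k (Coprod k A)).symm := by
  refine hom_ext (fun x y => ?_) (fun x y => ?_) fun i a => ?_
  · simp only [AlgHom.comp_apply, comulHom_br]
    exact tensorMap_br _ _ (fun _ _ => rfl) (counitHom_br k) _ _
  · change br k x y ⊗ₜ[k] (1 : k) = br k (x ⊗ₜ[k] (1 : k)) (y ⊗ₜ[k] (1 : k))
    rw [br_tmul, br_self, TensorProduct.tmul_zero, zero_add, mul_one]
  · have h : ∀ t : A i ⊗[k] A i, Algebra.TensorProduct.map (.id k _) (counitHom k A)
        (Algebra.TensorProduct.map (of k A i) (of k A i) t) =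
        Algebra.TensorProduct.map (of k A i) (.id k k) (Coalgebra.counit.lTensor (A i) t) :=
      fun t => by
        induction t with
        | zero => simp
        | add x y hx hy => simp only [map_add, hx, hy]
        | tmul a b => simp [counitHom_of]
    refine (h (Coalgebra.comul a)).trans ?_
    rw [Coalgebra.lTensor_counit_comul]
    rfl

instance : Bialgebra k (Coprod k A) :=
  .ofAlgHom (comulHom k A) (counitHom k A) (comulHom_coassoc k A)
    (counitHom_comp_comulHom_left k A) (counitHom_comp_comulHom_right k A)

instance : IsPoissonBialgebra k (Coprod k A) where
  comul_br := comulHom_br k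
  counit_br := counitHom_br k

end Coprod

end PoissonAlgebra

namespace PoissBialgCat

variable {k : Type u} [CommRing k]

/-- Morphisms of Poisson bialgebras from algebra maps. -/
def ofAlgHom {A B : PoissBialgCat.{u, v} k} (f : A →ₐ[k] B)
    (counit : ∀ a, Coalgebra.counit (R := k) (f a) = Coalgebra.counit (R := k) a)
    (comul : ∀ a, Coalgebra.comul (R := k) (f a) =
      Algebra.TensorProduct.map f f (Coalgebra.comul (R := k) a))
    (map_br : ∀ a b, f (br k a b) = br k (f a) (f b)) : A ⟶ B :=
  ⟨.ofAlgHom f (AlgHom.ext counit) (AlgHom.ext fun a => (comul a).symm), map_br⟩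

theorem hom_ext {A B : PoissBialgCat.{u, v} k} {f g : A ⟶ B} (h : ∀ a, f.hom a = g.hom a) :
    f = g :=
  Hom.ext (BialgHom.ext h)

theorem comp_apply {A B C : PoissBialgCat.{u, v} k} (f : A ⟶ B) (g : B ⟶ C) (a : A) :
    (f ≫ g).hom a = g.hom (f.hom a) := rfl

theorem counit_hom {A B : PoissBialgCat.{u, v} k} (f : A ⟶ B) (a : A) :
    Coalgebra.counit (R := k) (f.hom a) = Coalgebra.counit (R := k) a :=
  CoalgHomClass.counit_comp_apply f.hom a

theorem comul_hom {A B : PoissBialgCat.{u, v} k} (f : A ⟶ B) (a : A) :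
    Coalgebra.comul (R := k) (f.hom a) =
      Algebra.TensorProduct.map (f.hom : A →ₐ[k] B) (f.hom : A →ₐ[k] B)
        (Coalgebra.comul (R := k) a) :=
  (CoalgHomClass.map_comp_comul_apply f.hom a).symm

section Coproduct

-- Formal expressions involve scalars as well as elements of the `D i`, so the coproduct lives in a
-- universe at least that of `k`; hence `max u v`.
variable {ι : Type} (D : ι → PoissBialgCat.{u, max u v} k)

/-- The coproduct of a family of Poisson bialgebras. -/
abbrev coprod : PoissBialgCat.{u, max u v} k := .of (Coprod k fun i => D i)

/-- The injections into the coproduct. -/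
def coprodInj (i : ι) : D i ⟶ coprod D :=
  ofAlgHom (B := coprod D) (Coprod.of k (fun i => D i) i)
    (fun _ => rfl) (fun _ => rfl) (Coprod.of_br (k := k) (A := fun i => D i) i)

section Desc

variable {D} {T : PoissBialgCat.{u, max u v} k} (f : ∀ i, D i ⟶ T)

/-- The comparison map out of the coproduct, as an algebra map. -/
def coprodDescAlgHom : Coprod k (fun i => D i) →ₐ[k] T :=
  Coprod.lift (fun i => ((f i).hom : D i →ₐ[k] T)) fun i => (f i).map_br

theorem coprodDescAlgHom_br (x y : Coprod k fun i => D i) : coprodDescAlgHom f (br k x y) =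
    br k (coprodDescAlgHom f x) (coprodDescAlgHom f y) :=
  Coprod.lift_br _ (fun i => (f i).map_br) x y

theorem counit_comp_coprodDescAlgHom : (Bialgebra.counitAlgHom k T).comp (coprodDescAlgHom f) =
    Bialgebra.counitAlgHom k (Coprod k fun i => D i) := by
  refine Coprod.hom_ext (fun x y => ?_) (Coprod.counitHom_br k) fun i a => counit_hom (f i) a
  rw [AlgHom.comp_apply, coprodDescAlgHom_br]
  exact IsPoissonBialgebra.counit_br _ _

theorem comul_comp_coprodDescAlgHom : (Bialgebra.comulAlgHom k T).comp (coprodDescAlgHom f) =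
    (Algebra.TensorProduct.map (coprodDescAlgHom f) (coprodDescAlgHom f)).comp
      (Bialgebra.comulAlgHom k (Coprod k fun i => D i)) := by
  refine Coprod.hom_ext (fun x y => ?_) (fun x y => ?_) fun i a => ?_
  · rw [AlgHom.comp_apply, coprodDescAlgHom_br]
    exact IsPoissonBialgebra.comul_br _ _
  · rw [AlgHom.comp_apply]
    refine (congrArg _ (Coprod.comulHom_br k x y)).trans ?_
    exact tensorMap_br _ _ (coprodDescAlgHom_br f) (coprodDescAlgHom_br f) _ _
  · refine (comul_hom (f i) a).trans ?_
    have h : ((Algebra.TensorProduct.map (coprodDescAlgHom f) (coprodDescAlgHom f)).comp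
        (Algebra.TensorProduct.map (Coprod.of k (fun i => D i) i) (Coprod.of k (fun i => D i) i))) =
        Algebra.TensorProduct.map ((f i).hom : D i →ₐ[k] T) ((f i).hom : D i →ₐ[k] T) := by
      ext x <;> simp [coprodDescAlgHom] <;> rfl
    rw [← h]
    rfl

/-- The comparison map out of the coproduct. -/
def coprodDesc : coprod D ⟶ T :=
  ofAlgHom (A := coprod D) (coprodDescAlgHom f)
    (DFunLike.congr_fun (counit_comp_coprodDescAlgHom f))
    (DFunLike.congr_fun (comul_comp_coprodDescAlgHom f)) (coprodDescAlgHom_br f)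

end Desc

theorem coprodInj_desc {T : PoissBialgCat.{u, max u v} k} (f : ∀ i, D i ⟶ T) (i : ι) :
    coprodInj D i ≫ coprodDesc f = f i := rfl

/-- The Poisson bialgebra `coprod D` is a coproduct. -/
def isColimitCoprod : IsColimit (Cofan.mk (coprod D) (coprodInj D)) :=
  Cofan.IsColimit.mk _ (fun s => coprodDesc s.inj) (fun s i => coprodInj_desc D s.inj i)
    fun s (m : coprod D ⟶ s.pt) hm => by
      have h := Coprod.hom_ext (A := fun i => D i) (f := (m.hom : coprod D →ₐ[k] s.pt))
        (g := coprodDescAlgHom s.inj) m.map_br (coprodDescAlgHom_br s.inj)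
        fun i a => congrArg (fun φ => φ.hom a) (hm i)
      exact hom_ext fun x => DFunLike.congr_fun h x

/-- A coproduct of Poisson bialgebras is generated by the images of the injections. -/
theorem cofan_induction {D : ι → PoissBialgCat.{u, max u v} k} {c : Cofan D} (hc : IsColimit c)
    {p : c.pt → Prop} (x : c.pt)
    (inj : ∀ i a, p ((c.inj i).hom a)) (algebraMap : ∀ r : k, p (algebraMap k _ r))
    (add : ∀ x y, p x → p y → p (x + y)) (mul : ∀ x y, p x → p y → p (x * y))
    (br : ∀ x y, p x → p y → p (br k x y)) : p x := by
  let φ : coprod D ⟶ c.pt := coprodDesc c.inj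
  let ψ : c.pt ⟶ coprod D := Cofan.IsColimit.desc hc (coprodInj D)
  -- The given coproduct is a retract of the constructed one, so every element is the image of a
  -- formal expression and induction on expressions applies.
  have h : ψ ≫ φ = 𝟙 _ := Cofan.IsColimit.hom_ext hc _ _ fun i => by
    rw [← Category.assoc, Cofan.IsColimit.fac, coprodInj_desc, Category.comp_id]
  have hp : ∀ y : Coprod k fun i => D i, p (φ.hom y) := fun y => by
    induction y using Coprod.induction with
    | of i a => exact inj i a
    | algebraMap r => exact (AlgHomClass.commutes φ.hom r).symm ▸ algebraMap r
    | add x y hx hy => exact (map_add φ.hom x y).symm ▸ add _ _ hx hy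
    | mul x y hx hy => exact (map_mul φ.hom x y).symm ▸ mul _ _ hx hy
    | br x y hx hy => exact (φ.map_br x y).symm ▸ br _ _ hx hy
  have := hp (ψ.hom x)
  rwa [← comp_apply, h] at this

end Coproduct

end PoissBialgCat

/-! ## Convolution and antipodes -/

namespace PoissonAlgebra

open WithConv

section Convolution

variable {k X A B : Type*} [CommRing k] [AddCommGroup X] [Module k X] [Coalgebra k X]
  [CommRing A] [Algebra k A] [CommRing B] [Algebra k B]

/-- Postcomposition with an algebra map is multiplicative for the convolution product. -/
def convComp (h : A →ₐ[k] B) : WithConv (X →ₗ[k] A) →* WithConv (X →ₗ[k] B) where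
  toFun f := toConv (h.toLinearMap ∘ₗ f.ofConv)
  map_one' := by ext x; simp [LinearMap.convOne_def]
  map_mul' f g := WithConv.ext (LinearMap.algHom_comp_convMul_distrib h f g)

theorem convComp_apply (h : A →ₐ[k] B) (f : WithConv (X →ₗ[k] A)) :
    convComp h f = toConv (h.toLinearMap ∘ₗ f.ofConv) := rfl

-- Together with its mirror image below, this factors `(f ⊗ g) ∘ Δ`, and its flipped version, as
-- convolution products of maps into the two tensor factors. Statements about tensor squares become
-- computations in a monoid.
open Algebra.TensorProduct in
theorem convComp_includeLeft_mul (f g : WithConv (X →ₗ[k] A)) :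
    convComp (includeLeft (S := k) (B := A)) f * convComp includeRight g =
      toConv (TensorProduct.map f.ofConv g.ofConv ∘ₗ Coalgebra.comul) := by
  rw [LinearMap.convMul_def, ← LinearMap.comp_assoc]
  congr 2
  ext x y
  simp [convComp_apply]

open Algebra.TensorProduct in
theorem convComp_includeRight_mul (f g : WithConv (X →ₗ[k] A)) :
    convComp (includeRight (A := A)) g * convComp (includeLeft (S := k)) f =
      toConv (TensorProduct.map f.ofConv g.ofConv ∘ₗ
        (TensorProduct.comm k X X).toLinearMap ∘ₗ Coalgebra.comul) := by
  rw [LinearMap.convMul_def, ← LinearMap.comp_assoc, ← LinearMap.comp_assoc]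
  congr 2
  ext x y
  simp [convComp_apply]

/-- With `i₁`, `i₂` the inclusions of the factors, the product is `(i₂s)(i₁s)(i₁p)(i₂p)`, which
telescopes because `i₁` and `i₂` are multiplicative for convolution. The flip is what puts the inner
factors side by side. -/
theorem map_comm_comul_mul {s p : WithConv (X →ₗ[k] A)} (h : s * p = 1) :
    toConv (TensorProduct.map s.ofConv s.ofConv ∘ₗ
        (TensorProduct.comm k X X).toLinearMap ∘ₗ Coalgebra.comul) *
      toConv (TensorProduct.map p.ofConv p.ofConv ∘ₗ Coalgebra.comul) = 1 := by
  rw [← convComp_includeLeft_mul, ← convComp_includeRight_mul, mul_assoc,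
    ← mul_assoc (convComp _ s) (convComp _ p), ← map_mul, h, map_one, one_mul, ← map_mul, h, map_one]

theorem map_comul_mul {s p : WithConv (X →ₗ[k] A)} (h : p * s = 1) :
    toConv (TensorProduct.map p.ofConv p.ofConv ∘ₗ Coalgebra.comul) *
      toConv (TensorProduct.map s.ofConv s.ofConv ∘ₗ
        (TensorProduct.comm k X X).toLinearMap ∘ₗ Coalgebra.comul) = 1 := by
  rw [← convComp_includeLeft_mul, ← convComp_includeRight_mul, mul_assoc,
    ← mul_assoc (convComp _ p) (convComp _ s), ← map_mul, h, map_one, one_mul, ← map_mul, h, map_one]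

end Convolution

/-! ### Stability of the antipode relation under the bracket. -/

section BracketIdentity

variable {k A : Type*} [CommRing k] [CommRing A] [Algebra k A] [PoissonAlgebra k A]

/-- On the right the two copies of the mixed term `x[y,z]w` cancel. What matters is that the right
side brackets only with the products `z * w` and `x * y`. -/
theorem mul_br_sub_br_mul (x y z w : A) :
    x * z * br k y w - br k x z * (y * w) = x * br k y (z * w) - br k (x * y) z * w := by
  rw [leibniz, leibniz_left]
  ring

/-- The kernel of the multiplication map `A^{op} ⊗ A → A` is closed under the bracket. -/
theorem sum_mul_br_sub_br_mul {ι κ : Type*} (s : Finset ι) (t : Finset κ) (x y : ι → A)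
    (z w : κ → A) (r r' : k) (hx : ∑ i ∈ s, x i * y i = algebraMap k A r)
    (hz : ∑ j ∈ t, z j * w j = algebraMap k A r') :
    ∑ i ∈ s, ∑ j ∈ t, (x i * z j * br k (y i) (w j) - br k (x i) (z j) * (y i * w j)) = 0 := by
  simp only [mul_br_sub_br_mul, Finset.sum_sub_distrib]
  rw [Finset.sum_comm (f := fun i j => br k (x i * y i) (z j) * w j)]
  have h1 : ∀ i, ∑ j ∈ t, x i * br k (y i) (z j * w j) = 0 := fun i => by
    rw [← Finset.mul_sum, ← map_sum, hz, br_algebraMap, mul_zero]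
  have h2 : ∀ j, ∑ i ∈ s, br k (x i * y i) (z j) * w j = 0 := fun j => by
    rw [← Finset.sum_mul, ← LinearMap.sum_apply, ← map_sum, hx, algebraMap_br, zero_mul]
  simp [h1, h2]

end BracketIdentity

section Antipode

variable {k C Q : Type*} [CommRing k] [CommRing C] [Bialgebra k C] [PoissonAlgebra k C]
  [IsPoissonBialgebra k C] [CommRing Q] [Algebra k Q] [PoissonAlgebra k Q]

theorem counit_br_eq_zero (a b : C) : Coalgebra.counit (R := k) (br k a b) = 0 :=
  IsPoissonBialgebra.counit_br a b

theorem comul_br_repr (a b : C) :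
    Coalgebra.comul (R := k) (br k a b) =
      ∑ i ∈ (Coalgebra.Repr.arbitrary k a).index, ∑ j ∈ (Coalgebra.Repr.arbitrary k b).index,
        (((Coalgebra.Repr.arbitrary k a).left i * (Coalgebra.Repr.arbitrary k b).left j) ⊗ₜ[k]
          br k ((Coalgebra.Repr.arbitrary k a).right i) ((Coalgebra.Repr.arbitrary k b).right j) +
        br k ((Coalgebra.Repr.arbitrary k a).left i) ((Coalgebra.Repr.arbitrary k b).left j) ⊗ₜ[k]
          ((Coalgebra.Repr.arbitrary k a).right i * (Coalgebra.Repr.arbitrary k b).right j)) := by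
  rw [IsPoissonBialgebra.comul_br]
  conv_lhs => rw [← (Coalgebra.Repr.arbitrary k a).eq, ← (Coalgebra.Repr.arbitrary k b).eq]
  simp only [map_sum, LinearMap.sum_apply, br_tmul]
  rw [Finset.sum_comm]

/-- If `f` and `g` are algebra maps to a Poisson algebra which multiply the bracket by opposite
scalars, then `f * g = 1` is a condition closed under the Poisson bracket. -/
theorem convMul_br_eq (f g : C →ₐ[k] Q) (c : k)
    (hf : ∀ a b, f (br k a b) = -(c • br k (f a) (f b)))
    (hg : ∀ a b, g (br k a b) = c • br k (g a) (g b)) {a b : C}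
    (ha : (toConv f.toLinearMap * toConv g.toLinearMap) a = (1 : WithConv (C →ₗ[k] Q)) a)
    (hb : (toConv f.toLinearMap * toConv g.toLinearMap) b = (1 : WithConv (C →ₗ[k] Q)) b) :
    (toConv f.toLinearMap * toConv g.toLinearMap) (br k a b) =
      (1 : WithConv (C →ₗ[k] Q)) (br k a b) := by
  rw [(Coalgebra.Repr.arbitrary k a).convMul_apply, LinearMap.convOne_apply] at ha
  rw [(Coalgebra.Repr.arbitrary k b).convMul_apply, LinearMap.convOne_apply] at hb
  -- Here `x = f(a₁)`, `y = g(a₂)`, `z = f(b₁)`, `w = g(b₂)`; the two scalars are `ε(a)` and `ε(b)`.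
  have key := sum_mul_br_sub_br_mul _ _ _ _ _ _ _ _ ha hb
  rw [LinearMap.convMul_apply, LinearMap.convOne_apply, counit_br_eq_zero, map_zero,
    comul_br_repr]
  rw [← smul_zero c, ← key]
  simp only [map_sum, map_add, Finset.smul_sum, TensorProduct.map_tmul,
    AlgHom.toLinearMap_apply, LinearMap.mul'_apply, map_mul, hf, hg]
  refine Finset.sum_congr rfl fun i _ => Finset.sum_congr rfl fun j _ => ?_
  simp only [Algebra.smul_def]
  ring

end Antipode

/-! ### Antipodes: uniqueness, comultiplication and bracket. -/

section Hopf

variable {k H : Type*} [CommRing k] [CommRing H] [HopfAlgebra k H]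

open HopfAlgebra

/-- Both sides are convolution inverses of `Δ` in `Hom(H, H ⊗ H)`, one on the left and one on the
right, so they agree. -/
theorem comul_antipode (a : H) : Coalgebra.comul (R := k) (antipode k a) =
    Algebra.TensorProduct.map (antipodeAlgHom k H) (antipodeAlgHom k H)
      (TensorProduct.comm k H H (Coalgebra.comul (R := k) a)) := by
  have h := map_comm_comul_mul (LinearMap.antipode_mul_id (R := k) (C := H))
  rw [ofConv_toConv, ofConv_toConv, TensorProduct.map_id, LinearMap.id_comp] at h
  replace h := left_inv_eq_right_inv h (LinearMap.comul_right_inv (R := k) (C := H))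
  exact (LinearMap.congr_fun (congrArg ofConv h) a).symm

/-- `f ∘ S` is a left and `S ∘ f` a right convolution inverse of `f`. Hence the forgetful functor is
full. -/
theorem map_antipode_of_bialgHom {H' : Type*} [CommRing H'] [HopfAlgebra k H'] (f : H →ₐc[k] H')
    (a : H) : f (antipode k a) = antipode k (f a) := by
  have h1 : toConv ((f : H →ₐ[k] H').toLinearMap ∘ₗ antipode k) *
      toConv (f : H →ₐ[k] H').toLinearMap = 1 := by
    have := congrArg (convComp (f : H →ₐ[k] H')) (LinearMap.antipode_mul_id (R := k) (C := H))
    rwa [map_mul, map_one] at this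
  have h2 : toConv (f : H →ₐ[k] H').toLinearMap *
      toConv (antipode k ∘ₗ (f : H →ₐ[k] H').toLinearMap) = 1 := by
    have := LinearMap.convMul_comp_coalgHom_distrib (toConv LinearMap.id) (toConv (antipode k))
      (f : H →ₗc[k] H')
    rw [LinearMap.id_mul_antipode] at this
    refine WithConv.ext (this.symm.trans ?_)
    ext x
    simp [LinearMap.convOne_def]
  exact LinearMap.congr_fun (congrArg ofConv (left_inv_eq_right_inv h1 h2)) a

/-- This is `Id * S = 1` evaluated at products. It makes the multiplication right invertible in
`Hom(H ⊗ H, H)`, so that it can be cancelled in `antipode_br`. -/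
theorem mul'_convMul_antipode_comp_mul' :
    toConv (LinearMap.mul' k H) * toConv (antipode k ∘ₗ LinearMap.mul' k H) = 1 := by
  ext a b
  have h := congrArg (fun f : WithConv (H →ₗ[k] H) => f (a * b))
    (LinearMap.id_mul_antipode (R := k) (C := H))
  simp only [((Coalgebra.Repr.arbitrary k a).mul (Coalgebra.Repr.arbitrary k b)).convMul_apply] at h
  simp [((Coalgebra.Repr.arbitrary k a).tmul (Coalgebra.Repr.arbitrary k b)).convMul_apply] at h ⊢
  rw [h, mul_comm]

variable [PoissonAlgebra k H] [IsPoissonBialgebra k H]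

/-- The antipode of a Poisson Hopf algebra reverses the bracket. -/
theorem antipode_br (a b : H) :
    antipode k (br k a b) = br k (antipode k b) (antipode k a) := by
  let β : H ⊗[k] H →ₗ[k] H := TensorProduct.lift (br k)
  let T : H ⊗[k] H →ₗ[k] H :=
    antipode k ∘ₗ β + β ∘ₗ TensorProduct.map (antipode k) (antipode k)
  -- `T` measures the failure of `S` to reverse the bracket. The identity `(S * Id)([a,b]) = 0` and
  -- the bracket identity for `S(a₁)a₂ = ε(a)`, `S(b₁)b₂ = ε(b)` share the terms
  -- `S(a₁)S(b₁)[a₂,b₂]`; their difference is `(T * mul)(a ⊗ b)`.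
  have hT : toConv T * toConv (LinearMap.mul' k H) = 0 := by
    ext a b
    have h1 : LinearMap.mul' k H ((antipode k).rTensor H (Coalgebra.comul (br k a b))) = 0 := by
      rw [mul_antipode_rTensor_comul_apply, counit_br_eq_zero, map_zero]
    rw [comul_br_repr] at h1
    have h2 := sum_mul_br_sub_br_mul _ _ _ _ _ _ _ _
      (sum_antipode_mul_eq_algebraMap_counit (Coalgebra.Repr.arbitrary k a))
      (sum_antipode_mul_eq_algebraMap_counit (Coalgebra.Repr.arbitrary k b))
    refine (((Coalgebra.Repr.arbitrary k a).tmul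
      (Coalgebra.Repr.arbitrary k b)).convMul_apply (toConv T) _).trans ?_
    refine Eq.trans ?_ ((congrArg₂ (· - ·) h1 h2).trans (sub_zero 0))
    refine (Finset.sum_product _ _ _).trans ?_
    simp only [map_sum, map_add, LinearMap.rTensor_tmul, LinearMap.mul'_apply,
      ← Finset.sum_sub_distrib]
    refine Finset.sum_congr rfl fun i _ => Finset.sum_congr rfl fun j _ => ?_
    rw [antipode_mul_distrib]
    change (antipode k (br k (_ : H) _) + br k (antipode k (_ : H)) (antipode k (_ : H))) *
      ((Coalgebra.Repr.arbitrary k a).right i * (Coalgebra.Repr.arbitrary k b).right j) = _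
    ring
  have hT0 : toConv T = 0 := by
    rw [← mul_one (toConv T), ← mul'_convMul_antipode_comp_mul', ← mul_assoc, hT, zero_mul]
  have h : T (a ⊗ₜ b) = 0 := LinearMap.congr_fun (congrArg ofConv hT0) (a ⊗ₜ b)
  rw [br_swap (antipode k b)]
  exact eq_neg_of_add_eq_zero_left h

end Hopf

end PoissonAlgebra

/-! ## Antimorphisms of Poisson bialgebras -/

namespace PoissBialgCat

open WithConv

variable {k : Type u} [CommRing k]

/-- Algebra maps that reverse the bracket and the comultiplication. -/
structure AntiHom (A B : PoissBialgCat.{u, v} k) where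
  /-- the underlying algebra map -/
  hom : A →ₐ[k] B
  counit_hom : ∀ a, Coalgebra.counit (R := k) (hom a) = Coalgebra.counit (R := k) a
  comul_hom : ∀ a, Coalgebra.comul (R := k) (hom a) =
    Algebra.TensorProduct.map hom hom (TensorProduct.comm k A A (Coalgebra.comul (R := k) a))
  map_br : ∀ a b, hom (br k a b) = br k (hom b) (hom a)

theorem map_map_apply {A B C : Type*} [CommRing A] [Algebra k A] [CommRing B] [Algebra k B]
    [CommRing C] [Algebra k C] (f : A →ₐ[k] B) (g : B →ₐ[k] C) (t : A ⊗[k] A) :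
    Algebra.TensorProduct.map g g (Algebra.TensorProduct.map f f t) =
      Algebra.TensorProduct.map (g.comp f) (g.comp f) t := by
  rw [← AlgHom.comp_apply, ← Algebra.TensorProduct.map_comp]

theorem comm_map_apply {A B : Type*} [CommRing A] [Algebra k A] [CommRing B] [Algebra k B]
    (f : A →ₐ[k] B) (t : A ⊗[k] A) :
    TensorProduct.comm k B B (Algebra.TensorProduct.map f f t) =
      Algebra.TensorProduct.map f f (TensorProduct.comm k A A t) :=
  (TensorProduct.map_comm f.toLinearMap f.toLinearMap t).symm

theorem comm_comm_apply {A : Type*} [CommRing A] [Algebra k A] (t : A ⊗[k] A) :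
    TensorProduct.comm k A A (TensorProduct.comm k A A t) = t :=
  (TensorProduct.comm k A A).symm_apply_apply t

namespace AntiHom

variable {A B C : PoissBialgCat.{u, v} k}

/-- The composition of an antimorphism and a morphism. -/
def postcomp (S : AntiHom A B) (f : B ⟶ C) : AntiHom A C where
  hom := (f.hom : B →ₐ[k] C).comp S.hom
  counit_hom a := (PoissBialgCat.counit_hom f _).trans (S.counit_hom a)
  comul_hom a := by
    refine (PoissBialgCat.comul_hom f (S.hom a)).trans ?_
    rw [S.comul_hom, map_map_apply]
  map_br a b := (congrArg f.hom (S.map_br a b)).trans (f.map_br _ _)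

/-- The composition of a morphism and an antimorphism. -/
def precomp (f : A ⟶ B) (S : AntiHom B C) : AntiHom A C where
  hom := S.hom.comp (f.hom : A →ₐ[k] B)
  counit_hom a := (S.counit_hom _).trans (PoissBialgCat.counit_hom f a)
  comul_hom a := by
    refine (S.comul_hom (f.hom a)).trans ?_
    rw [PoissBialgCat.comul_hom f a, comm_map_apply, map_map_apply]
  map_br a b := (congrArg S.hom (f.map_br a b)).trans (S.map_br _ _)

/-- The composition of two antimorphisms. -/
def comp (S : AntiHom A B) (T : AntiHom B C) : A ⟶ C :=
  ofAlgHom (T.hom.comp S.hom) (fun a => (T.counit_hom _).trans (S.counit_hom a))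
    (fun a => by
      refine (T.comul_hom (S.hom a)).trans ?_
      rw [S.comul_hom, comm_map_apply, comm_comm_apply, map_map_apply])
    (fun a b => (congrArg T.hom (S.map_br a b)).trans (T.map_br _ _))

variable (A) in
/-- The identity `A → A^{op,cop}`. -/
def toOp : AntiHom A A.opCop where
  hom := (OpCop.equiv k A : A →ₐ[k] OpCop A)
  counit_hom _ := rfl
  comul_hom a := OpCop.comul_equiv k a
  map_br _ _ := rfl

variable (A) in
/-- The identity `A^{op,cop} → A`. -/
def ofOp : AntiHom A.opCop A where
  hom := ((OpCop.equiv k A).symm : OpCop A →ₐ[k] A)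
  counit_hom _ := rfl
  comul_hom a := by
    obtain ⟨a, rfl⟩ := (OpCop.equiv k A).surjective a
    have h := OpCop.comul_equiv k a
    refine Eq.trans ?_ (congrArg (fun t => Algebra.TensorProduct.map
      ((OpCop.equiv k A).symm : OpCop A →ₐ[k] A) ((OpCop.equiv k A).symm : OpCop A →ₐ[k] A)
      (TensorProduct.comm k (OpCop A) (OpCop A) t)) h).symm
    have h' := comm_map_apply ((OpCop.equiv k A : A ≃ₐ[k] OpCop A) : A →ₐ[k] OpCop A)
      (TensorProduct.comm k A A (Coalgebra.comul (R := k) a))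
    refine Eq.trans ?_ (congrArg (Algebra.TensorProduct.map
      ((OpCop.equiv k A).symm : OpCop A →ₐ[k] A) ((OpCop.equiv k A).symm : OpCop A →ₐ[k] A))
      h').symm
    rw [comm_comm_apply, map_map_apply]
    have h3 : ((OpCop.equiv k A).symm : OpCop A →ₐ[k] A).comp
        ((OpCop.equiv k A : A ≃ₐ[k] OpCop A) : A →ₐ[k] OpCop A) = .id k A := rfl
    rw [h3, Algebra.TensorProduct.map_id]
    rfl
  map_br _ _ := rfl

/-- An antimorphism `A → B` is a morphism `A → B^{op,cop}`. -/
def toHom (S : AntiHom A B) : A ⟶ B.opCop := S.comp (toOp B)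

/-- A morphism `A → B^{op,cop}` is an antimorphism `A → B`. -/
def ofHom (S : A ⟶ B.opCop) : AntiHom A B := precomp S (ofOp B)

end AntiHom

/-- The antipode of a Poisson Hopf algebra. -/
def antipodeAnti (H : PoissHopfCat.{u, v} k) :
    AntiHom ((forgetPoissHopf k).obj H) ((forgetPoissHopf k).obj H) where
  hom := (HopfAlgebra.antipodeAlgHom k H : H →ₐ[k] H)
  counit_hom := HopfAlgebra.counit_antipode (R := k) (A := H)
  comul_hom := comul_antipode (k := k) (H := H)
  map_br := antipode_br (k := k) (H := H)

section AltCopy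

variable (B : PoissBialgCat.{u, v} k)

/-- The identity map `Bₙ → Bₙ₊₁`. -/
def stepUp : ∀ n, AntiHom (B.altCopy n) (B.altCopy (n + 1))
  | 0 => AntiHom.toOp B
  | 1 => AntiHom.ofOp B
  -- `altCopy` has period two by definition, so the recursion is well typed without any transport.
  | n + 2 => stepUp n

theorem stepUp_toCopy : ∀ n b, (B.stepUp n).hom (B.toCopy n b) = B.toCopy (n + 1) b
  | 0, _ => rfl
  | 1, _ => rfl
  | n + 2, b => stepUp_toCopy n b

/-- The identity map `Bₙ₊₁ → Bₙ`. -/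
def stepDown : ∀ n, AntiHom (B.altCopy (n + 1)) (B.altCopy n)
  | 0 => AntiHom.ofOp B
  | 1 => AntiHom.toOp B
  | n + 2 => stepDown n

theorem stepDown_toCopy : ∀ n b, (B.stepDown n).hom (B.toCopy (n + 1) b) = B.toCopy n b
  | 0, _ => rfl
  | 1, _ => rfl
  | n + 2, b => stepDown_toCopy n b

end AltCopy

/-! ## The ideal of the antipode relations -/

section Defect

variable {C D : PoissBialgCat.{u, v} k}

/-- Algebra maps on the left and coalgebra maps on the right distribute over convolution. Vanishing
of the image of a defect thus becomes an identity in the monoid `Hom(D, A)`; taking `q = 𝟙` covers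
arbitrary elements of `C`. -/
theorem map_leftDefect {A : Type*} [CommRing A] [Algebra k A] (h : C →ₐ[k] A) (S : C →ₗ[k] C)
    (q : D ⟶ C) (x : D) :
    h (leftDefect S (q.hom x)) =
      (toConv (h.toLinearMap ∘ₗ S ∘ₗ (q.hom : D →ₐ[k] C).toLinearMap) *
        toConv (h.toLinearMap ∘ₗ (q.hom : D →ₐ[k] C).toLinearMap)) x -
        (1 : WithConv (D →ₗ[k] A)) x := by
  have h1 := LinearMap.algHom_comp_convMul_distrib h (toConv S) (toConv (LinearMap.id (M := C)))
  have h2 := LinearMap.convMul_comp_coalgHom_distrib (toConv (h.toLinearMap ∘ₗ S))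
    (toConv h.toLinearMap) (q.hom : D →ₗc[k] C)
  rw [LinearMap.comp_assoc] at h2
  refine (map_sub h _ _).trans (congrArg₂ (· - ·) ?_ ?_)
  · exact (LinearMap.congr_fun h1 (q.hom x)).trans (LinearMap.congr_fun h2 x)
  · refine (AlgHom.commutes h _).trans (congrArg _ (counit_hom q x))

theorem map_rightDefect {A : Type*} [CommRing A] [Algebra k A] (h : C →ₐ[k] A) (S : C →ₗ[k] C)
    (q : D ⟶ C) (x : D) :
    h (rightDefect S (q.hom x)) =
      (toConv (h.toLinearMap ∘ₗ (q.hom : D →ₐ[k] C).toLinearMap) *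
        toConv (h.toLinearMap ∘ₗ S ∘ₗ (q.hom : D →ₐ[k] C).toLinearMap)) x -
        (1 : WithConv (D →ₗ[k] A)) x := by
  have h1 := LinearMap.algHom_comp_convMul_distrib h (toConv (LinearMap.id (M := C))) (toConv S)
  have h2 := LinearMap.convMul_comp_coalgHom_distrib (toConv h.toLinearMap)
    (toConv (h.toLinearMap ∘ₗ S)) (q.hom : D →ₗc[k] C)
  rw [LinearMap.comp_assoc] at h2
  refine (map_sub h _ _).trans (congrArg₂ (· - ·) ?_ ?_)
  · exact (LinearMap.congr_fun h1 (q.hom x)).trans (LinearMap.congr_fun h2 x)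
  · refine (AlgHom.commutes h _).trans (congrArg _ (counit_hom q x))

end Defect

end PoissBialgCat

/-! ### Generated Poisson ideals and kernels. -/

namespace PoissonAlgebra

section Span

variable {k A A' : Type*} [CommRing k] [CommRing A] [Algebra k A] [PoissonAlgebra k A]
  [CommRing A'] [Algebra k A'] [PoissonAlgebra k A'] {s : Set A}

theorem isPoissonIdeal_poissonSpan : IsPoissonIdeal k (poissonSpan k s) := fun a x hx => by
  simp only [poissonSpan, Submodule.mem_sInf] at hx ⊢
  exact fun I hI => hI.2 a x (hx I hI)

theorem subset_poissonSpan : s ⊆ poissonSpan k s := fun x hx => by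
  simp only [poissonSpan, SetLike.mem_coe, Submodule.mem_sInf]
  exact fun I hI => hI.1 hx

theorem poissonSpan_le {I : Ideal A} (hI : IsPoissonIdeal k I) (h : s ⊆ I) :
    poissonSpan k s ≤ I :=
  sInf_le ⟨h, hI⟩

theorem isPoissonIdeal_ker (f : A →ₐ[k] A') (hf : ∀ a b, f (br k a b) = br k (f a) (f b)) :
    IsPoissonIdeal k (RingHom.ker f) := fun a x hx => by
  rw [RingHom.mem_ker] at hx ⊢
  rw [hf, hx, map_zero]

end Span

end PoissonAlgebra

namespace PoissBialgCat

open WithConv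

variable {k : Type u} [CommRing k]

section Ideal

variable {D : ℕ → PoissBialgCat.{u, v} k} {C : PoissBialgCat.{u, v} k} (q : ∀ n, D n ⟶ C)

theorem leftDefect_mem (S : C →ₗ[k] C) (n : ℕ) (x : D n) :
    leftDefect S ((q n).hom x) ∈ antipodeIdeal q S :=
  subset_poissonSpan ⟨n, x, .inl rfl⟩

theorem rightDefect_mem (S : C →ₗ[k] C) (n : ℕ) (x : D n) :
    rightDefect S ((q n).hom x) ∈ antipodeIdeal q S :=
  subset_poissonSpan ⟨n, x, .inr rfl⟩

theorem isPoissonIdeal_antipodeIdeal (S : C →ₗ[k] C) : IsPoissonIdeal k (antipodeIdeal q S) :=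
  isPoissonIdeal_poissonSpan

theorem antipodeIdeal_le {S : C →ₗ[k] C} {J : Ideal C} (hJ : IsPoissonIdeal k J)
    (hl : ∀ n x, leftDefect S ((q n).hom x) ∈ J) (hr : ∀ n x, rightDefect S ((q n).hom x) ∈ J) :
    antipodeIdeal q S ≤ J :=
  poissonSpan_le hJ (by rintro _ ⟨n, x, rfl | rfl⟩ <;> [exact hl n x; exact hr n x])

variable (σ : AntiHom C C)

/-- `ε` is a Poisson map, so its kernel is a Poisson ideal and only generators need checking. There
`ε ∘ σ ∘ qₙ` and `ε ∘ qₙ` both equal the convolution unit. -/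
theorem counit_eq_zero_of_mem_antipodeIdeal {x : C}
    (hx : x ∈ antipodeIdeal q σ.hom.toLinearMap) : Coalgebra.counit (R := k) x = 0 := by
  have hσ (n : ℕ) : toConv ((Bialgebra.counitAlgHom k C).toLinearMap ∘ₗ σ.hom.toLinearMap ∘ₗ
      ((q n).hom : D n →ₐ[k] C).toLinearMap) = 1 :=
    WithConv.ext <| LinearMap.ext fun x => (σ.counit_hom _).trans (counit_hom (q n) x)
  have hq (n : ℕ) : toConv ((Bialgebra.counitAlgHom k C).toLinearMap ∘ₗ
      ((q n).hom : D n →ₐ[k] C).toLinearMap) = 1 :=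
    WithConv.ext <| LinearMap.ext fun x => counit_hom (q n) x
  refine antipodeIdeal_le q (J := RingHom.ker (Bialgebra.counitAlgHom k C))
    (isPoissonIdeal_ker _ IsPoissonBialgebra.counit_br) (fun n x => ?_) (fun n x => ?_) hx
  · rw [RingHom.mem_ker, map_leftDefect, hσ, hq, one_mul, sub_self]
  · rw [RingHom.mem_ker, map_rightDefect, hσ, hq, one_mul, sub_self]

/-- The map `C ⊗ C → C ⧸ I ⊗ C ⧸ I`, restricted along the comultiplication. -/
def comulMod (I : Ideal C) : C →ₐ[k] (C ⧸ I) ⊗[k] (C ⧸ I) :=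
  (Algebra.TensorProduct.map (Ideal.Quotient.mkₐ k I) (Ideal.Quotient.mkₐ k I)).comp
    (Bialgebra.comulAlgHom k C)

/-- Since `I` is a Poisson ideal, `C/I ⊗ C/I` carries a bracket for which `comulMod` is a Poisson
map. -/
theorem isPoissonIdeal_ker_comulMod {I : Ideal C} (hI : IsPoissonIdeal k I) :
    IsPoissonIdeal k (RingHom.ker (comulMod (k := k) I)) := by
  let := PoissonAlgebra.quotient I hI
  refine isPoissonIdeal_ker _ fun a b => ?_
  refine (congrArg _ (IsPoissonBialgebra.comul_br (k := k) a b)).trans ?_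
  exact tensorMap_br _ _ (fun _ _ => rfl) (fun _ _ => rfl) _ _

/-- Modulo `I`, the maps `s` and `p` induced by `σ ∘ qₙ` and `qₙ` are convolution inverse by the
very choice of generators. Passing to tensor squares gives the same for `comulMod ∘ σ ∘ qₙ` and
`comulMod ∘ qₙ`, which says that the generators die in `C/I ⊗ C/I`. -/
theorem comulMod_eq_zero_of_mem_antipodeIdeal {x : C}
    (hx : x ∈ antipodeIdeal q σ.hom.toLinearMap) :
    comulMod (antipodeIdeal q σ.hom.toLinearMap) x = 0 := by
  set I := antipodeIdeal q σ.hom.toLinearMap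
  let π := Ideal.Quotient.mkₐ k I
  let s (n : ℕ) := toConv (π.toLinearMap ∘ₗ σ.hom.toLinearMap ∘ₗ
    ((q n).hom : D n →ₐ[k] C).toLinearMap)
  let p (n : ℕ) := toConv (π.toLinearMap ∘ₗ ((q n).hom : D n →ₐ[k] C).toLinearMap)
  have hsp (n : ℕ) : s n * p n = 1 := WithConv.ext <| LinearMap.ext fun x => by
    have h := map_leftDefect π σ.hom.toLinearMap (q n) x
    exact (sub_eq_zero.1 (h.symm.trans (Ideal.Quotient.eq_zero_iff_mem.2 (leftDefect_mem q _ n x))))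
  have hps (n : ℕ) : p n * s n = 1 := WithConv.ext <| LinearMap.ext fun x => by
    have h := map_rightDefect π σ.hom.toLinearMap (q n) x
    exact (sub_eq_zero.1
      (h.symm.trans (Ideal.Quotient.eq_zero_iff_mem.2 (rightDefect_mem q _ n x))))
  have hq (n : ℕ) : (comulMod (k := k) I).toLinearMap ∘ₗ ((q n).hom : D n →ₐ[k] C).toLinearMap =
      TensorProduct.map (p n).ofConv (p n).ofConv ∘ₗ Coalgebra.comul := LinearMap.ext fun x => by
    refine (congrArg (Algebra.TensorProduct.map π π) (comul_hom (q n) x)).trans ?_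
    exact map_map_apply _ _ _
  have hσ (n : ℕ) : (comulMod (k := k) I).toLinearMap ∘ₗ σ.hom.toLinearMap ∘ₗ
      ((q n).hom : D n →ₐ[k] C).toLinearMap =
      TensorProduct.map (s n).ofConv (s n).ofConv ∘ₗ
        (TensorProduct.comm k (D n) (D n)).toLinearMap ∘ₗ Coalgebra.comul :=
      LinearMap.ext fun x => by
    refine (congrArg (Algebra.TensorProduct.map π π)
      ((AntiHom.precomp (q n) σ).comul_hom x)).trans ?_
    exact map_map_apply _ _ _
  refine antipodeIdeal_le q (isPoissonIdeal_ker_comulMod (isPoissonIdeal_antipodeIdeal q _))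
    (fun n x => ?_) (fun n x => ?_) hx
  · rw [RingHom.mem_ker, map_leftDefect, hσ, hq, map_comm_comul_mul (hsp n), sub_self]
  · rw [RingHom.mem_ker, map_rightDefect, hσ, hq, map_comul_mul (hps n), sub_self]

/-- Applying `σ` to `σ(x₁)x₂` gives `σ(σ(x₁))σ(x₂)`. As `Δ(σ(x)) = σ(x₂) ⊗ σ(x₁)` and the product
commutes, this is `(Id * σ)(σ(x))`. -/
theorem AntiHom.map_leftDefect (x : C) :
    σ.hom (leftDefect σ.hom.toLinearMap x) = rightDefect σ.hom.toLinearMap (σ.hom x) := by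
  refine (map_sub σ.hom _ _).trans (congrArg₂ (· - ·) ?_ ?_)
  · refine Eq.trans ?_ (congrArg (fun t => LinearMap.mul' k C
      (TensorProduct.map .id σ.hom.toLinearMap t)) (σ.comul_hom x)).symm
    change σ.hom (LinearMap.mul' k C (TensorProduct.map σ.hom.toLinearMap .id (Coalgebra.comul x))) = _
    induction (Coalgebra.comul x : C ⊗[k] C) with
    | zero => simp
    | add t t' h h' => simp only [map_add, h, h']
    | tmul a b => simp [mul_comm]
  · exact (AlgHom.commutes _ _).trans (congrArg _ (σ.counit_hom x).symm)

theorem AntiHom.map_rightDefect (x : C) :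
    σ.hom (rightDefect σ.hom.toLinearMap x) = leftDefect σ.hom.toLinearMap (σ.hom x) := by
  refine (map_sub σ.hom _ _).trans (congrArg₂ (· - ·) ?_ ?_)
  · refine Eq.trans ?_ (congrArg (fun t => LinearMap.mul' k C
      (TensorProduct.map σ.hom.toLinearMap .id t)) (σ.comul_hom x)).symm
    change σ.hom (LinearMap.mul' k C (TensorProduct.map .id σ.hom.toLinearMap (Coalgebra.comul x))) = _
    induction (Coalgebra.comul x : C ⊗[k] C) with
    | zero => simp
    | add t t' h h' => simp only [map_add, h, h']
    | tmul a b => simp [mul_comm]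
  · exact (AlgHom.commutes _ _).trans (congrArg _ (σ.counit_hom x).symm)

theorem map_mem_antipodeIdeal (hσ : ∀ n x, ∃ y, σ.hom ((q n).hom x) = (q (n + 1)).hom y) {x : C}
    (hx : x ∈ antipodeIdeal q σ.hom.toLinearMap) :
    σ.hom x ∈ antipodeIdeal q σ.hom.toLinearMap := by
  refine antipodeIdeal_le q (J := (antipodeIdeal q σ.hom.toLinearMap).comap σ.hom)
    (fun a x hx => ?_) (fun n x => ?_) (fun n x => ?_) hx
  · rw [Ideal.mem_comap] at hx ⊢
    rw [σ.map_br, br_swap]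
    exact neg_mem (isPoissonIdeal_antipodeIdeal q _ _ _ hx)
  · obtain ⟨y, hy⟩ := hσ n x
    rw [Ideal.mem_comap, AntiHom.map_leftDefect, hy]
    exact rightDefect_mem q _ _ y
  · obtain ⟨y, hy⟩ := hσ n x
    rw [Ideal.mem_comap, AntiHom.map_rightDefect, hy]
    exact leftDefect_mem q _ _ y

theorem isPoissonHopfIdeal_antipodeIdeal
    (hσ : ∀ n x, ∃ y, σ.hom ((q n).hom x) = (q (n + 1)).hom y) :
    IsPoissonHopfIdeal (antipodeIdeal q σ.hom.toLinearMap) σ.hom.toLinearMap where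
  isPoissonIdeal := isPoissonIdeal_antipodeIdeal q _
  counit_eq_zero _ hx := counit_eq_zero_of_mem_antipodeIdeal q σ hx
  comul_mem := ((Submodule.isCoideal_iff_comul_mem
    ((antipodeIdeal q σ.hom.toLinearMap).restrictScalars k)).1
    ⟨fun _ hx => counit_eq_zero_of_mem_antipodeIdeal q σ hx,
      fun _ hx => comulMod_eq_zero_of_mem_antipodeIdeal q σ hx⟩).2
  map_mem _ hx := map_mem_antipodeIdeal q σ hσ hx

end Ideal

end PoissBialgCat

/-! ## The free Poisson Hopf algebra -/

namespace PoissBialgCat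

open WithConv

variable {k : Type u} [CommRing k]

/-! ### The antipode axioms on the whole quotient. -/

section AntipodeMod

variable {D : ℕ → PoissBialgCat.{u, max u v} k} {c : Cofan D}

/-- An antimorphism of a coproduct of Poisson bialgebras is an antipode modulo the Poisson ideal of
the antipode relations. -/
theorem isAntipodeMod_antipodeIdeal (hc : IsColimit c) (σ : AntiHom c.pt c.pt) :
    IsAntipodeMod (antipodeIdeal c.inj σ.hom.toLinearMap) σ.hom.toLinearMap := by
  set I := antipodeIdeal c.inj σ.hom.toLinearMap
  let := PoissonAlgebra.quotient I (isPoissonIdeal_antipodeIdeal c.inj _)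
  let π : c.pt →ₐ[k] c.pt ⧸ I := Ideal.Quotient.mkₐ k I
  let s : c.pt →ₐ[k] c.pt ⧸ I := π.comp σ.hom
  have hπ (a b) : π (br k a b) = br k (π a) (π b) := rfl
  have hs (a b) : s (br k a b) = -br k (s a) (s b) := by
    rw [← br_swap]
    exact congrArg π (σ.map_br a b)
  -- The target is commutative, so convolution products of algebra maps are again algebra maps. This
  -- settles scalars, sums and products in the induction below.
  let F : c.pt →ₐ[k] c.pt ⧸ I := (toConv s * toConv π).ofConv
  let G : c.pt →ₐ[k] c.pt ⧸ I := (toConv π * toConv s).ofConv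
  let E : c.pt →ₐ[k] c.pt ⧸ I := (Algebra.ofId k _).comp (Bialgebra.counitAlgHom k c.pt)
  have hl (x : c.pt) : leftDefect σ.hom.toLinearMap x ∈ I ↔ F x = E x :=
    Ideal.Quotient.eq_zero_iff_mem.symm.trans
      ((Eq.congr_left (map_leftDefect π σ.hom.toLinearMap (𝟙 c.pt) x)).trans sub_eq_zero)
  have hr (x : c.pt) : rightDefect σ.hom.toLinearMap x ∈ I ↔ G x = E x :=
    Ideal.Quotient.eq_zero_iff_mem.symm.trans
      ((Eq.congr_left (map_rightDefect π σ.hom.toLinearMap (𝟙 c.pt) x)).trans sub_eq_zero)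
  have key : ∀ x : c.pt, F x = E x ∧ G x = E x := fun x => by
    induction x using cofan_induction hc with
    | inj n x =>
      exact ⟨(hl _).1 (leftDefect_mem c.inj _ n x), (hr _).1 (rightDefect_mem c.inj _ n x)⟩
    | algebraMap r => simp only [AlgHom.commutes, and_self]
    | add x y hx hy => simp only [map_add, hx, hy, and_self]
    | mul x y hx hy => simp only [map_mul, hx, hy, and_self]
    | br x y hx hy =>
      -- `s` reverses the bracket and `π` preserves it; for the product in the other order the signs
      -- are exchanged, hence `c = -1`.
      refine ⟨convMul_br_eq s π 1 (fun a b => ?_) (fun a b => ?_) hx.1 hy.1,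
        convMul_br_eq π s (-1) (fun a b => ?_) (fun a b => ?_) hx.2 hy.2⟩
      · rw [one_smul, hs]
      · rw [one_smul, hπ]
      · rw [neg_one_smul, neg_neg, hπ]
      · rw [neg_one_smul, hs]
  exact ⟨fun x => (hl x).2 (key x).1, fun x => (hr x).2 (key x).2⟩

end AntipodeMod

section Quotient

/-- A bialgebra map that vanishes on a biideal `I` factors through the quotient by `I`. -/
def quotientBialgHom {C H : Type*} [CommRing C] [Bialgebra k C] [CommRing H] [Bialgebra k H]
    (I : Ideal C) [(I.restrictScalars k).IsCoideal] (f : C →ₐc[k] H) (hf : ∀ x ∈ I, f x = 0) :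
    (C ⧸ I) →ₐc[k] H :=
  .ofAlgHom (Ideal.Quotient.liftₐ I (f : C →ₐ[k] H) hf)
    (Ideal.Quotient.algHom_ext k (AlgHom.ext fun x => CoalgHomClass.counit_comp_apply f x))
    (Ideal.Quotient.algHom_ext k (AlgHom.ext fun x =>
      (map_map_apply (Ideal.Quotient.mkₐ k I) (Ideal.Quotient.liftₐ I (f : C →ₐ[k] H) hf)
        (Coalgebra.comul x)).trans (CoalgHomClass.map_comp_comul_apply f x)))

theorem _root_.PoissHopfCat.hom_ext {H H' : PoissHopfCat.{u, v} k} {f g : H ⟶ H'}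
    (h : ∀ a, f.hom a = g.hom a) : f = g :=
  PoissHopfCat.Hom.ext (BialgHom.ext h)

/-- A morphism of Poisson bialgebras between Poisson Hopf algebras preserves the antipode. -/
def liftHopf {H H' : PoissHopfCat.{u, v} k}
    (f : (forgetPoissHopf k).obj H ⟶ (forgetPoissHopf k).obj H') : H ⟶ H' :=
  let F : H →ₐc[k] H' := f.hom
  ⟨F, f.map_br, map_antipode_of_bialgHom F⟩

variable {C : PoissBialgCat.{u, v} k} {I : Ideal C} {S : C →ₗ[k] C} (h : IsPoissonHopfIdeal I S)
  (h' : IsAntipodeMod I S) {H : PoissHopfCat.{u, v} k}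

/-- A morphism that vanishes on `I` factors through `C ⧸ I`. -/
def quotientDesc (φ : C ⟶ (forgetPoissHopf k).obj H) (hφ : ∀ x ∈ I, φ.hom x = 0) :
    quotient I S h h' ⟶ H :=
  haveI := h.isCoideal
  liftHopf ⟨quotientBialgHom I φ.hom hφ, by rintro ⟨x⟩ ⟨y⟩; exact φ.map_br x y⟩

theorem toQuotient_desc (φ : C ⟶ (forgetPoissHopf k).obj H) (hφ : ∀ x ∈ I, φ.hom x = 0) :
    toQuotient I S h h' ≫ (forgetPoissHopf k).map (quotientDesc h h' φ hφ) = φ := rfl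

theorem quotient_hom_ext {f g : quotient I S h h' ⟶ H}
    (hfg : toQuotient I S h h' ≫ (forgetPoissHopf k).map f =
      toQuotient I S h h' ≫ (forgetPoissHopf k).map g) : f = g := by
  refine PoissHopfCat.hom_ext ?_
  rintro ⟨x⟩
  exact congrArg (fun φ => φ.hom x) hfg

/-- A morphism to a Poisson Hopf algebra that intertwines the antimorphism `σ` and the antipode
vanishes on the ideal of the antipode relations. -/
theorem eq_zero_of_mem_antipodeIdeal {H : Type*} [CommRing H] [HopfAlgebra k H]
    [PoissonAlgebra k H] {D : ℕ → PoissBialgCat.{u, v} k} (q : ∀ n, D n ⟶ C)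
    (σ : AntiHom C C) (φ : C →ₐc[k] H) (hbr : ∀ a b, φ (br k a b) = br k (φ a) (φ b))
    (hφ : ∀ x, φ (σ.hom x) = HopfAlgebra.antipode k (φ x)) {x : C}
    (hx : x ∈ antipodeIdeal q σ.hom.toLinearMap) : φ x = 0 := by
  let F : C →ₐ[k] H := φ
  have hS : F.toLinearMap ∘ₗ σ.hom.toLinearMap =
      HopfAlgebra.antipode k ∘ₗ F.toLinearMap := LinearMap.ext hφ
  have hl (y : C) : F (leftDefect σ.hom.toLinearMap y) = 0 := by
    refine (map_leftDefect F σ.hom.toLinearMap (𝟙 C) y).trans (sub_eq_zero.2 ?_)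
    have h := LinearMap.convMul_comp_coalgHom_distrib (toConv (HopfAlgebra.antipode k (A := H)))
      (toConv LinearMap.id) (φ : C →ₗc[k] H)
    rw [LinearMap.antipode_mul_id] at h
    refine Eq.trans ?_ ((LinearMap.congr_fun h y).symm.trans
      (congrArg (algebraMap k H) (CoalgHomClass.counit_comp_apply φ y)))
    exact congrArg (fun f => (toConv f * toConv F.toLinearMap) y) hS
  have hr (y : C) : F (rightDefect σ.hom.toLinearMap y) = 0 := by
    refine (map_rightDefect F σ.hom.toLinearMap (𝟙 C) y).trans (sub_eq_zero.2 ?_)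
    have h := LinearMap.convMul_comp_coalgHom_distrib (toConv LinearMap.id)
      (toConv (HopfAlgebra.antipode k (A := H))) (φ : C →ₗc[k] H)
    rw [LinearMap.id_mul_antipode] at h
    refine Eq.trans ?_ ((LinearMap.congr_fun h y).symm.trans
      (congrArg (algebraMap k H) (CoalgHomClass.counit_comp_apply φ y)))
    exact congrArg (fun f => (toConv F.toLinearMap * toConv f) y) hS
  exact antipodeIdeal_le q (J := RingHom.ker F) (isPoissonIdeal_ker F hbr)
    (fun _ _ => hl _) (fun _ _ => hr _) hx

end Quotient

/-! ### The shift on the coproduct and the universal property. -/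

section Free

variable {B : PoissBialgCat.{u, max u v} k} {c : Cofan B.altCopy} (hc : IsColimit c)

theorem altCopy_hom_ext {T : PoissBialgCat.{u, max u v} k} {f g : c.pt ⟶ T}
    (h : ∀ n b, f.hom ((c.inj n).hom (B.toCopy n b)) = g.hom ((c.inj n).hom (B.toCopy n b)))
    (hc : IsColimit c) : f = g :=
  Cofan.IsColimit.hom_ext hc _ _ fun n => hom_ext fun x => by
    obtain ⟨b, rfl⟩ := (B.toCopy n).surjective x
    exact h n b

/-- The shift `qₙ(b) ↦ qₙ₊₁(b)` of the coproduct of the alternating copies. -/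
def shift : c.pt ⟶ c.pt.opCop :=
  Cofan.IsColimit.desc hc fun n => ((B.stepUp n).postcomp (c.inj (n + 1))).toHom

theorem shift_inj (n : ℕ) (b : B) : endo (shift hc) ((c.inj n).hom (B.toCopy n b)) =
    (c.inj (n + 1)).hom (B.toCopy (n + 1) b) := by
  have h := Cofan.IsColimit.fac hc
    (fun n => ((B.stepUp n).postcomp (c.inj (n + 1))).toHom) n
  refine (congrArg (fun φ => φ.hom (B.toCopy n b)) h).trans ?_
  exact congrArg (c.inj (n + 1)).hom (B.stepUp_toCopy n b)

theorem shift_unique (T : c.pt ⟶ c.pt.opCop)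
    (hT : ∀ (n : ℕ) (b : B), endo T ((c.inj n).hom (B.toCopy n b)) =
      (c.inj (n + 1)).hom (B.toCopy (n + 1) b)) : T = shift hc :=
  altCopy_hom_ext (fun n b => (hT n b).trans (shift_inj hc n b).symm) hc

theorem exists_shift_inj (n : ℕ) (x : B.altCopy n) :
    ∃ y, endo (shift hc) ((c.inj n).hom x) = (c.inj (n + 1)).hom y := by
  obtain ⟨b, rfl⟩ := (B.toCopy n).surjective x
  exact ⟨_, shift_inj hc n b⟩

theorem isPoissonHopfIdeal_shift :
    IsPoissonHopfIdeal (antipodeIdeal c.inj (endo (shift hc))) (endo (shift hc)) :=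
  isPoissonHopfIdeal_antipodeIdeal c.inj (AntiHom.ofHom (shift hc)) (exists_shift_inj hc)

theorem isAntipodeMod_shift :
    IsAntipodeMod (antipodeIdeal c.inj (endo (shift hc))) (endo (shift hc)) :=
  isAntipodeMod_antipodeIdeal hc (AntiHom.ofHom (shift hc))

variable {H : PoissHopfCat.{u, max u v} k} (f : B ⟶ (forgetPoissHopf k).obj H)

/-- The morphisms `Sⁿ ∘ f : Bₙ → H`, where `S` is the antipode of `H`. -/
def altHom : ∀ n, B.altCopy n ⟶ (forgetPoissHopf k).obj H
  | 0 => f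
  -- The identity `Bₙ₊₁ → Bₙ` and the antipode both reverse the structure, so the composite is an
  -- honest morphism.
  | n + 1 => (B.stepDown n).comp (AntiHom.precomp (altHom n) (antipodeAnti H))

theorem altHom_succ_toCopy (n : ℕ) (b : B) : (altHom f (n + 1)).hom (B.toCopy (n + 1) b) =
    (antipodeAnti H).hom ((altHom f n).hom (B.toCopy n b)) := by
  rw [← B.stepDown_toCopy n b]
  rfl

/-- The extension of `f : B → H` to the coproduct of the alternating copies. -/
def altDesc : c.pt ⟶ (forgetPoissHopf k).obj H :=
  Cofan.IsColimit.desc hc (altHom f)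

theorem altDesc_inj (n : ℕ) (x : B.altCopy n) :
    (altDesc hc f).hom ((c.inj n).hom x) = (altHom f n).hom x :=
  congrArg (fun φ => φ.hom x) (Cofan.IsColimit.fac hc (altHom f) n)

/-- Both sides are antimorphisms `C → H`, hence morphisms into the opposite of `H`. By the universal
property of `C` it suffices to compare them at `qₙ(b)`, where `altHom` was built to satisfy the
identity. -/
theorem altDesc_shift (x : c.pt) : (altDesc hc f).hom ((AntiHom.ofHom (shift hc)).hom x) =
    (antipodeAnti H).hom ((altDesc hc f).hom x) := by
  have h : ((AntiHom.ofHom (shift hc)).postcomp (altDesc hc f)).toHom =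
      (AntiHom.precomp (altDesc hc f) (antipodeAnti H)).toHom :=
    altCopy_hom_ext (fun n b => by
      refine (congrArg (altDesc hc f).hom (shift_inj hc n b)).trans ?_
      refine Eq.trans ?_ (congrArg (antipodeAnti H).hom (altDesc_inj hc f n (B.toCopy n b))).symm
      rw [altDesc_inj, altHom_succ_toCopy]) hc
  exact congrArg (fun φ => φ.hom x) h

theorem altDesc_eq_zero {x : c.pt} (hx : x ∈ antipodeIdeal c.inj (endo (shift hc))) :
    (altDesc hc f).hom x = 0 :=
  let F : c.pt →ₐc[k] H := (altDesc hc f).hom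
  eq_zero_of_mem_antipodeIdeal c.inj (AntiHom.ofHom (shift hc)) F
    (altDesc hc f).map_br (altDesc_shift hc f) hx

/-- The quotient of the coproduct by the antipode relations is the free Poisson Hopf algebra. -/
theorem existsUnique_quotient_hom
    (h : IsPoissonHopfIdeal (antipodeIdeal c.inj (endo (shift hc))) (endo (shift hc)))
    (h' : IsAntipodeMod (antipodeIdeal c.inj (endo (shift hc))) (endo (shift hc))) :
    ∃! g : quotient _ _ h h' ⟶ H,
      (c.inj 0 : B ⟶ c.pt) ≫ toQuotient _ _ h h' ≫ (forgetPoissHopf k).map g = f := by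
  refine ⟨quotientDesc h h' (altDesc hc f) fun x hx => altDesc_eq_zero hc f hx, ?_, ?_⟩
  · exact Cofan.IsColimit.fac hc (altHom f) 0
  · intro g hg
    -- Uniqueness needs only the values at the classes of `qₙ(b)`. They follow by induction from `n
    -- = 0`, since `qₙ₊₁(b) = S'(qₙ(b))`, `S'` induces the antipode of the quotient, and `g`
    -- preserves antipodes.
    refine quotient_hom_ext h h' (altCopy_hom_ext (fun n b => ?_) hc)
    rw [toQuotient_desc, altDesc_inj]
    induction n with
    | zero => exact congrArg (fun φ => φ.hom b) hg
    | succ n ih =>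
      rw [altHom_succ_toCopy, ← ih, ← shift_inj hc]
      exact g.map_antipode ((toQuotient _ _ h h').hom ((c.inj n).hom (B.toCopy n b)))

end Free

/-! ### The reflection. -/

section Reflective

variable (k)

instance : (forgetPoissHopf.{u, v} k).Full := ⟨fun f => ⟨liftHopf f, rfl⟩⟩

instance : (forgetPoissHopf.{u, v} k).Faithful :=
  ⟨fun h => PoissHopfCat.hom_ext fun a => congrArg (fun φ => φ.hom a) h⟩

variable {k}

/-- The free Poisson Hopf algebra on `B`. -/
def freeHopf (B : PoissBialgCat.{u, max u v} k) : PoissHopfCat.{u, max u v} k :=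
  quotient _ _ (isPoissonHopfIdeal_shift (isColimitCoprod B.altCopy))
    (isAntipodeMod_shift (isColimitCoprod B.altCopy))

/-- The unit of the free Poisson Hopf algebra. -/
def toFreeHopf (B : PoissBialgCat.{u, max u v} k) : B ⟶ (forgetPoissHopf k).obj (freeHopf B) :=
  coprodInj B.altCopy 0 ≫ toQuotient _ _ _ _

theorem existsUnique_freeHopf_hom {B : PoissBialgCat.{u, max u v} k}
    {H : PoissHopfCat.{u, max u v} k} (f : B ⟶ (forgetPoissHopf k).obj H) :
    ∃! g : freeHopf B ⟶ H, toFreeHopf B ≫ (forgetPoissHopf k).map g = f :=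
  existsUnique_quotient_hom (isColimitCoprod B.altCopy) f _ _

/-- The universal property of the free Poisson Hopf algebra. -/
def freeHopfEquiv (B : PoissBialgCat.{u, max u v} k) (H : PoissHopfCat.{u, max u v} k) :
    (freeHopf B ⟶ H) ≃ (B ⟶ (forgetPoissHopf k).obj H) :=
  .ofBijective (fun g => toFreeHopf B ≫ (forgetPoissHopf k).map g)
    ((Function.bijective_iff_existsUnique _).2 existsUnique_freeHopf_hom)

/-- Poisson Hopf algebras are a reflective subcategory of Poisson bialgebras. -/
theorem nonempty_reflective_forgetPoissHopf :
    Nonempty (Reflective (forgetPoissHopf.{u, max u v} k)) :=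
  ⟨{  L := Adjunction.leftAdjointOfEquiv freeHopfEquiv fun X Y Y' g h => by
        change _ ≫ (forgetPoissHopf k).map (h ≫ g) = (_ ≫ _) ≫ _
        rw [Functor.map_comp, Category.assoc]
      adj := Adjunction.adjunctionOfEquivLeft freeHopfEquiv _ }⟩

end Reflective

end PoissBialgCat

end

theorem theorem3p2 (k : Type u) [Field k] :
    -- Poisson Hopf algebras form a reflective (full) subcategory of Poisson bialgebras
    Nonempty (Reflective (forgetPoissHopf.{u, max u v} k)) ∧
    ∀ B : PoissBialgCat.{u, max u v} k,
      -- the coproduct of the alternating copies of `B` and `B^{op,cop}` exists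
      HasCoproduct B.altCopy ∧
      -- and, for any coproduct `C = c.pt` of these copies, with injections `c.inj n`:
      ∀ (c : Cofan B.altCopy) (_ : IsColimit c),
        -- there is a unique `S' : C → C^{op,cop}` with `S' ∘ qₙ = qₙ₊₁`
        ∃ S' : c.pt ⟶ c.pt.opCop,
          (∀ (n : ℕ) (b : B), PoissBialgCat.endo S' ((c.inj n).hom (B.toCopy n b)) =
            (c.inj (n + 1)).hom (B.toCopy (n + 1) b)) ∧
          (∀ T : c.pt ⟶ c.pt.opCop,
            (∀ (n : ℕ) (b : B), PoissBialgCat.endo T ((c.inj n).hom (B.toCopy n b)) =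
              (c.inj (n + 1)).hom (B.toCopy (n + 1) b)) → T = S') ∧
          -- the Poisson ideal of the antipode relations is a Hopf ideal, `S'` is an antipode
          -- modulo it, and the quotient by it is the free Poisson Hopf algebra on `B`
          ∃ (h : PoissBialgCat.IsPoissonHopfIdeal
                (PoissBialgCat.antipodeIdeal c.inj (PoissBialgCat.endo S')) (PoissBialgCat.endo S'))
            (h' : PoissBialgCat.IsAntipodeMod
                (PoissBialgCat.antipodeIdeal c.inj (PoissBialgCat.endo S')) (PoissBialgCat.endo S')),
            ∀ (H : PoissHopfCat.{u, max u v} k) (f : B ⟶ (forgetPoissHopf k).obj H),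
              ∃! g : PoissBialgCat.quotient _ _ h h' ⟶ H,
                (c.inj 0 : B ⟶ c.pt) ≫ PoissBialgCat.toQuotient _ _ h h' ≫
                  (forgetPoissHopf k).map g = f :=
  ⟨PoissBialgCat.nonempty_reflective_forgetPoissHopf, fun B =>
    ⟨⟨⟨_, PoissBialgCat.isColimitCoprod B.altCopy⟩⟩, fun _ hc =>
      ⟨PoissBialgCat.shift hc, PoissBialgCat.shift_inj hc, PoissBialgCat.shift_unique hc,
        PoissBialgCat.isPoissonHopfIdeal_shift hc, PoissBialgCat.isAntipodeMod_shift hc,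
        fun _ f => PoissBialgCat.existsUnique_quotient_hom hc f _ _⟩⟩⟩
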